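/- **Setting.** Let $G=(V,E)$ be a finite directed acyclic graph with $V\neq\emptyset$ (parallel edges allowed); each edge $e$ goes from its tail to its head. A source (sink) is a vertex without incoming (outgoing) edges; the other vertices, which are neither sources nor sinks, are internal. Let $\mathbf a\in\mathbb Z^V$ be *conservationist*: $\mathbf a_i=1$ at every source, $\mathbf a_i<0$ at every sink, $\mathbf a_i=0$ at every internal vertex. The flow polytope $\mathcal F_G(\mathbf a)$ is the set of $F:E\to\mathbb R_{\ge 0}$ such that for every vertex $i$ the sum of $F$ over edges leaving $i$ minus the sum over edges entering $i$ equals $\mathbf a_i$ (such $F$ are the $\mathbf a$-flows). A *framing* $\mathfrak F$ consists of a total order on the outgoing edges of each non-sink vertex, a total order on the incoming edges of each internal vertex, and a total order on the sources. **Routes.** A route is a directed path from a source to a sink; its indicator vector $I(p)\in\mathbb R^E$ is $1$ on the edges of $p$ and $0$ elsewhere. Two distinct paths from a vertex $i$ to sinks are compared by $<_i^+$ according to the framing order of the first edges in which they differ; two distinct paths from sources to a non-sink vertex $i$ are compared by $<_i^-$ according to the framing order of the last edges in which they differ. Two routes $p,q$ are *incompatible* if they share a vertex $i$ at which, up to exchanging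 $p$ and $q$, the part of $p$ before $i$ is $<_i^-$ that of $q$ while the part of $q$ after $i$ is $<_i^+$ that of $p$. A *route-clique* is a set of pairwise compatible routes. **Layerings.** A *layering* is a set $L$ of routes with exactly one route starting at each source and exactly $|\mathbf a_j|$ routes ending at each sink $j$; put $J(L)=\sum_{p\in L}I(p)$. For distinct layerings $L,M$ let $s$ be the largest source, in the framing order, at which the routes of $L$ and $M$ starting there differ; write $L<M$ if the route of $L$ from $s$ is $<_s^+$ that of $M$. For a set $\mathcal K$ of layerings let $\mathrm{routes}(\mathcal K)$ be the set of all routes occurring in its members. A finite set $\mathcal L=\{L^1<\dots<L^m\}$ of layerings ($m\ge 0$) is a *layering-simplex* if 1. $\mathrm{routes}(\mathcal L)$ is a route-clique; 2. for every $i$, $L^i$ is the $<$-minimum of all layerings $L$ with $L\subseteq \mathrm{routes}(\{L^i,\dots,L^m\})$; 3. for every $i$, some route of $L^i$ is not in $\mathrm{routes}(\{L^{i+1},\dots,L^m\})$. Its polyhedral layering-simplex $\Delta_1(\mathcal L)$ is the set of all $\mathbf a$-flows of the form $\sum_{L\in\mathcal L}c_LJ(L)$ with all $c_L\ge 0$.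 **Triangulations.** An integer polytope in $\mathbb R^E$ is the convex hull of a finite set of points of $\mathbb Z^E$; it is an integer simplex if these points can be taken affinely independent ($\emptyset$ is allowed). A lattice triangulation of an integer polytope $P$ is a finite set $\mathcal T$ of integer simplices with union $P$ that contains every face (including $\emptyset$) of each of its members and such that the intersection of any two members is a (possibly empty) face of both. It is unimodular if each nonempty member has normalized volume $1$ within its affine span, where the normalized volume of a $d$-dimensional simplex is $d!$ times its volume measured so that the lattice of integer points of the direction space of its affine span has covolume $1$. **Statement.** The polytope $\mathcal F_G(\mathbf a)$ is an integer polytope, and $$\mathcal T(G,\mathbf a,\mathfrak F)=\{\Delta_1(\mathcal L):\mathcal L\text{ is a layering-simplex}\}$$ is a unimodular lattice triangulation of it. Moreover, for every layering-simplex $\mathcal L$ the vectors $J(L)$, $L\in\mathcal L$, are affinely independent and $\Delta_1(\mathcal L)$ is their convex hull (so $\Delta_1(\mathcal L)$ is a simplex), and for all layering-simplices $\mathcal K,\mathcal L$ one has $\Delta_1(\mathcal K)\cap\Delta_1(\mathcal L)=\Delta_1(\mathcal K\cap\mathcal L)$. -/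

import Mathlib

noncomputable section

/-! ### Lattice polytopes and triangulations in `ℝ^E` -/

/-- A point of `ℝ^E` all of whose coordinates are integers. -/
def IsIntegerPoint {E : Type*} (x : E → ℝ) : Prop :=
  ∀ e, ∃ n : ℤ, x e = n

/-- An integer polytope: the convex hull of finitely many integer points (possibly empty). -/
def IsIntegerPolytope {E : Type*} (P : Set (E → ℝ)) : Prop :=
  ∃ s : Finset (E → ℝ), (∀ v ∈ s, IsIntegerPoint v) ∧ P = convexHull ℝ (s : Set (E → ℝ))

/-- An integer simplex: the convex hull of finitely many affinely independent integer points.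
The empty set counts as the simplex without vertices. -/
def IsIntegerSimplex {E : Type*} (S : Set (E → ℝ)) : Prop :=
  ∃ s : Finset (E → ℝ), (∀ v ∈ s, IsIntegerPoint v) ∧
    AffineIndependent ℝ (fun v : s => (v : E → ℝ)) ∧ S = convexHull ℝ (s : Set (E → ℝ))

/-- The lattice `D ∩ ℤ^E` of integer points of a linear subspace `D` of `ℝ^E`. -/
def integerPointsIn {E : Type*} (D : Submodule ℝ (E → ℝ)) : Submodule ℤ D where
  carrier := {w | IsIntegerPoint (w : E → ℝ)}
  zero_mem' := fun e => ⟨0, by simp⟩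
  add_mem' := by
    intro x y hx hy e
    obtain ⟨m, hm⟩ := hx e
    obtain ⟨n, hn⟩ := hy e
    exact ⟨m + n, by simp [hm, hn]⟩
  smul_mem' := by
    intro c x hx e
    obtain ⟨m, hm⟩ := hx e
    exact ⟨c * m, by simp [hm]⟩

/-- The volume of a subset `A` of a linear subspace `D` of `ℝ^E`, in the unit in which the lattice
`D ∩ ℤ^E` has covolume `1`. It does not depend on the choice of the Haar measure on `D`. -/
def latticeVolume {E : Type*} [Fintype E] (D : Submodule ℝ (E → ℝ)) (A : Set D) : ℝ :=
  (MeasureTheory.Measure.addHaar : MeasureTheory.Measure D).real A /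
    ZLattice.covolume (integerPointsIn D) MeasureTheory.Measure.addHaar

/-- The normalized volume of `P` within its affine span: if `d` is the dimension of `P`, it is `d!`
times the volume of `P`, translated by one of its points into the direction of its affine span
(the choice of the point does not matter). It is `0` for `P = ∅`. -/
def normalizedVolume {E : Type*} [Fintype E] (P : Set (E → ℝ)) : ℝ :=
  open Classical in
  if h : P.Nonempty then
    (Nat.factorial (Module.finrank ℝ (vectorSpan ℝ P)) : ℝ) *
      latticeVolume (vectorSpan ℝ P) {w | h.some + (w : E → ℝ) ∈ P}
  else 0

/-- A lattice triangulation of a polytope `P`. The faces of a simplex are its exposed faces, that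
is, the empty set and the sets of maximizers of linear functionals (the simplex itself included). -/
structure IsLatticeTriangulation {E : Type*} (P : Set (E → ℝ)) (T : Set (Set (E → ℝ))) :
    Prop where
  isIntegerPolytope : IsIntegerPolytope P
  finite : T.Finite
  isIntegerSimplex : ∀ S ∈ T, IsIntegerSimplex S
  cover : P = ⋃₀ T
  face_mem : ∀ S ∈ T, ∀ S', IsExposed ℝ S S' → S' ∈ T
  inter_face : ∀ S₁ ∈ T, ∀ S₂ ∈ T, IsExposed ℝ S₁ (S₁ ∩ S₂) ∧ IsExposed ℝ S₂ (S₁ ∩ S₂)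

/-- A triangulation is unimodular if each of its (nonempty) simplices has normalized volume `1`
within its affine span. -/
def IsUnimodularLatticeTriangulation {E : Type*} [Fintype E] (P : Set (E → ℝ))
    (T : Set (Set (E → ℝ))) : Prop :=
  IsLatticeTriangulation P T ∧ ∀ S ∈ T, S.Nonempty → normalizedVolume S = 1

/-! ### Directed graphs, netflow vectors and flow polytopes -/

/-- A directed graph with vertex set `V` and edge set `E`; parallel edges are allowed. -/
structure DirectedMultigraph (V E : Type*) where
  tail : E → V
  head : E → V

namespace DirectedMultigraph

variable {V E : Type*}

/-- There is no oriented cycle. -/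
def IsAcyclic (G : DirectedMultigraph V E) : Prop :=
  ∀ v, ¬ Relation.TransGen (fun u w => ∃ e, G.tail e = u ∧ G.head e = w) v v

def IsSource (G : DirectedMultigraph V E) (v : V) : Prop := ∀ e, G.head e ≠ v

def IsSink (G : DirectedMultigraph V E) (v : V) : Prop := ∀ e, G.tail e ≠ v

/-- A vertex that is neither a source nor a sink. -/
def IsInternal (G : DirectedMultigraph V E) (v : V) : Prop := ¬ G.IsSource v ∧ ¬ G.IsSink v

/-- The set of nonnegative `a`-flows of `G`. -/
def flowPolytope [Fintype E] (G : DirectedMultigraph V E) (a : V → ℤ) : Set (E → ℝ) :=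
  open Classical in
  {F | (∀ e, 0 ≤ F e) ∧
    ∀ v, (∑ e with G.tail e = v, F e) - (∑ e with G.head e = v, F e) = (a v : ℝ)}

structure IsConservationist (G : DirectedMultigraph V E) (a : V → ℤ) : Prop where
  source : ∀ v, G.IsSource v → a v = 1
  sink : ∀ v, G.IsSink v → a v < 0
  internal : ∀ v, G.IsInternal v → a v = 0

/-- A framing: total orders on the outgoing edges of each non-sink vertex, on the incoming edges
of each internal vertex, and on the source vertices. -/
structure Framing (G : DirectedMultigraph V E) where
  outOrder : ∀ v, ¬ G.IsSink v → LinearOrder {e : E // G.tail e = v}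
  inOrder : ∀ v, G.IsInternal v → LinearOrder {e : E // G.head e = v}
  srcOrder : LinearOrder {v : V // G.IsSource v}

/-! ### Routes and their compatibility -/

/-- `G.IsPath u l v` says that the list of edges `l` is a directed path from `u` to `v`. -/
def IsPath (G : DirectedMultigraph V E) : V → List E → V → Prop
  | u, [], v => u = v
  | u, e :: l, v => G.tail e = u ∧ G.IsPath (G.head e) l v

/-- A route: a path from a source to a sink. -/
@[ext]
structure Route (G : DirectedMultigraph V E) where
  start : V
  edges : List E
  finish : V
  isSource : G.IsSource start
  isSink : G.IsSink finish
  isPath : G.IsPath start edges finish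

/-- The indicator vector of a route in `ℝ^E`. -/
def Route.indicator {G : DirectedMultigraph V E} (p : G.Route) : E → ℝ :=
  open Classical in
  fun e => if e ∈ p.edges then 1 else 0

variable {G : DirectedMultigraph V E}

/-- `e` and `f` leave the same vertex and `e` is smaller in the framing order there. -/
def Framing.OutLT (Φ : G.Framing) (e f : E) : Prop :=
  ∃ (v : V) (hv : ¬ G.IsSink v) (he : G.tail e = v) (hf : G.tail f = v),
    (Φ.outOrder v hv).lt ⟨e, he⟩ ⟨f, hf⟩

/-- `e` and `f` enter the same internal vertex and `e` is smaller in the framing order there. -/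
def Framing.InLT (Φ : G.Framing) (e f : E) : Prop :=
  ∃ (v : V) (hv : G.IsInternal v) (he : G.head e = v) (hf : G.head f = v),
    (Φ.inOrder v hv).lt ⟨e, he⟩ ⟨f, hf⟩

/-- The post-order on paths (edge lists) from a common vertex to sinks: `p` and `q` are compared
by the first edges in which they differ. -/
def Framing.PostLT (Φ : G.Framing) (p q : List E) : Prop :=
  ∃ (σ p' q' : List E) (f g : E), p = σ ++ f :: p' ∧ q = σ ++ g :: q' ∧ Φ.OutLT f g

/-- The pre-order on paths (edge lists) from sources to a common vertex: `p` and `q` are compared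
by the last edges in which they differ. -/
def Framing.PreLT (Φ : G.Framing) (p q : List E) : Prop :=
  ∃ (σ p' q' : List E) (f g : E), p = p' ++ f :: σ ∧ q = q' ++ g :: σ ∧ Φ.InLT f g

/-- The route `p` passes through the vertex `i`, with part `p₁` before `i` and part `p₂` after. -/
def Route.SplitsAt (p : G.Route) (i : V) (p₁ p₂ : List E) : Prop :=
  p.edges = p₁ ++ p₂ ∧ G.IsPath p.start p₁ i ∧ G.IsPath i p₂ p.finish

/-- `p` and `q` share the vertex `i` and are ordered oppositely before and after `i`. -/
def Framing.IncompatibleAt (Φ : G.Framing) (p q : G.Route) (i : V) : Prop :=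
  ∃ p₁ p₂ q₁ q₂ : List E, p.SplitsAt i p₁ p₂ ∧ q.SplitsAt i q₁ q₂ ∧
    ((Φ.PreLT p₁ q₁ ∧ Φ.PostLT q₂ p₂) ∨ (Φ.PreLT q₁ p₁ ∧ Φ.PostLT p₂ q₂))

/-- A set of pairwise compatible routes. -/
def Framing.IsRouteClique (Φ : G.Framing) (R : Set G.Route) : Prop :=
  ∀ p ∈ R, ∀ q ∈ R, ∀ i, ¬ Φ.IncompatibleAt p q i

/-! ### Layerings -/

/-- A layering: a set of routes, exactly one of which starts at each source and exactly `|a j|` of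
which end at each sink `j`. -/
@[ext]
structure Layering (G : DirectedMultigraph V E) (a : V → ℤ) where
  routes : Finset G.Route
  existsUnique_start : ∀ s, G.IsSource s → ∃! p, p ∈ routes ∧ p.start = s
  card_finish : ∀ j, G.IsSink j → (({p ∈ (routes : Set G.Route) | p.finish = j}.ncard : ℕ) : ℤ) = |a j|

variable {a : V → ℤ}

instance : DecidableEq (G.Layering a) := Classical.decEq _

/-- The route of a layering that starts at the source `s`. -/
def Layering.routeFrom (L : G.Layering a) (s : {v : V // G.IsSource v}) : G.Route :=
  (L.existsUnique_start s s.2).choose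

/-- The indicator vector of a layering: the sum of the indicator vectors of its routes. -/
def Layering.indicator (L : G.Layering a) : E → ℝ := ∑ p ∈ L.routes, p.indicator

/-- The post-source order: compare the routes from the largest source at which they differ. -/
def Framing.LayeringLT (Φ : G.Framing) (L M : G.Layering a) : Prop :=
  ∃ s : {v : V // G.IsSource v}, Φ.PostLT (L.routeFrom s).edges (M.routeFrom s).edges ∧
    ∀ t, Φ.srcOrder.lt s t → L.routeFrom t = M.routeFrom t

/-- The set of all routes used by a set of layerings. -/
def routesOf (K : Set (G.Layering a)) : Set G.Route := {p | ∃ L ∈ K, p ∈ L.routes}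

/-- A finite set `K` of layerings is a layering-simplex if its routes are a route-clique and each
`L ∈ K` is the smallest of all layerings that use only routes of the members of `K` that are at
least `L`, and has a route that is in no member of `K` larger than `L`. -/
structure Framing.IsLayeringSimplex (Φ : G.Framing) (K : Finset (G.Layering a)) : Prop where
  clique : Φ.IsRouteClique (routesOf (K : Set (G.Layering a)))
  minimal : ∀ L ∈ K, ∀ M : G.Layering a,
    (∀ p ∈ M.routes, p ∈ routesOf {N | N ∈ K ∧ (L = N ∨ Φ.LayeringLT L N)}) →
      L = M ∨ Φ.LayeringLT L M
  new_route : ∀ L ∈ K, ∃ p ∈ L.routes, p ∉ routesOf {N | N ∈ K ∧ Φ.LayeringLT L N}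

/-- The polyhedral layering-simplex: the `a`-flows that are nonnegative combinations of the
indicator vectors of the layerings in `K`. -/
def polyhedralSimplex [Fintype E] (K : Finset (G.Layering a)) : Set (E → ℝ) :=
  {F | F ∈ G.flowPolytope a ∧
    ∃ c : G.Layering a → ℝ, (∀ L ∈ K, 0 ≤ c L) ∧ F = ∑ L ∈ K, c L • L.indicator}

/-- The set of the polyhedral layering-simplices of all layering-simplices. -/
def framingTriangulation [Fintype E] (a : V → ℤ) (Φ : G.Framing) : Set (Set (E → ℝ)) :=
  {S | ∃ K : Finset (G.Layering a), Φ.IsLayeringSimplex K ∧ S = polyhedralSimplex K}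

end DirectedMultigraph

end

/-! The proof attaches to every `a`-flow a unique positive combination of the layerings of a
layering-simplex, in two stages that each have an existence and a uniqueness half.

From flows to routes. If two routes of a decomposition are incompatible at a vertex, exchanging
their tails there leaves the flow unchanged, and a suitable weight of the decomposition goes up. A
decomposition of maximal weight therefore uses the routes of a clique
(`IsFlow.exists_decomposition`). Conversely, in a clique the units of flow through a vertex that
arrive lower also leave lower. Hence the flow alone dictates which units take which edge, and the
coefficient of a route is given by a formula in sums, differences and minima of the values of the
flow (`Framing.coefficient_eq`). Such a formula sends integer flows to integers
(`Framing.coefficient_mem`).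

From routes to layerings. A weight with mass `x` at each source and `x * |a j|` at each sink `j`
contains a layering in its support, by Hall's theorem (`exists_layering`). Peeling off the least
such layering until one of its routes is exhausted, and repeating, yields a layering-simplex
(`Framing.exists_layeringSimplex`). Nothing in this is a choice: the least member of a
layering-simplex is the least layering in the support, and its new route fixes its coefficient
(`Framing.IsLayeringSimplex.unique`). The new routes also make the passage from layerings to routes
unitriangular, so integer route weights have integer layering coefficients
(`Framing.IsLayeringSimplex.coeff_mem`).

Existence says that the simplices cover the polytope, and uniqueness that two of them meet in the
simplex of their common layerings. Integrality of coefficients says that the edge vectors of a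
simplex at one of its vertices form a basis of the lattice in its direction space, so its normalized
volume is `1`. -/

noncomputable section

open scoped Classical

namespace DirectedMultigraph

variable {V E : Type*} {G : DirectedMultigraph V E}

/-! ### Paths -/

theorem isPath_append {u v : V} {l m : List E} :
    G.IsPath u (l ++ m) v ↔ ∃ w, G.IsPath u l w ∧ G.IsPath w m v := by
  induction l generalizing u with
  | nil => simp [IsPath]
  | cons e l ih => simp [IsPath, ih, and_assoc]

theorem isPath_append_cons {u v : V} {l m : List E} {e : E} :
    G.IsPath u (l ++ e :: m) v ↔ G.IsPath u l (G.tail e) ∧ G.IsPath (G.head e) m v := by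
  rw [isPath_append]
  constructor
  · rintro ⟨w, h, rfl, h'⟩
    exact ⟨h, h'⟩
  · rintro ⟨h, h'⟩
    exact ⟨_, h, rfl, h'⟩

theorem isPath_concat {u v : V} {l : List E} {e : E} :
    G.IsPath u (l ++ [e]) v ↔ G.IsPath u l (G.tail e) ∧ G.head e = v :=
  isPath_append_cons

theorem IsPath.eq_nil_of_isSink {u v : V} {l : List E} (h : G.IsPath u l v) (hu : G.IsSink u) :
    l = [] := by
  cases l with
  | nil => rfl
  | cons e l => exact absurd h.1 (hu e)

theorem IsPath.eq_nil_of_isSource {u v : V} {l : List E} (h : G.IsPath u l v)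
    (hv : G.IsSource v) : l = [] := by
  rcases l.eq_nil_or_concat' with rfl | ⟨l, e, rfl⟩
  · rfl
  · exact absurd (isPath_concat.1 h).2 (hv e)

theorem not_isSink_tail (e : E) : ¬ G.IsSink (G.tail e) := fun h => h e rfl

theorem not_isSource_head (e : E) : ¬ G.IsSource (G.head e) := fun h => h e rfl

/-- The number of ancestors of a vertex grows strictly along edges. All later inductions along paths
run over such a rank. -/
theorem IsAcyclic.exists_rank [Finite V] (hG : G.IsAcyclic) :
    ∃ t : V → ℕ, ∀ e, t (G.tail e) < t (G.head e) := by
  refine ⟨fun v =>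
    {u | Relation.TransGen (fun u w => ∃ e, G.tail e = u ∧ G.head e = w) u v}.ncard, fun e => ?_⟩
  apply Set.ncard_lt_ncard _ (Set.toFinite _)
  refine ⟨fun u hu => Relation.TransGen.tail hu ⟨e, rfl, rfl⟩, fun h => ?_⟩
  exact hG _ (h (Relation.TransGen.single ⟨e, rfl, rfl⟩))

section Rank

variable {t : V → ℕ}

theorem IsPath.rank_le (ht : ∀ e, t (G.tail e) < t (G.head e)) {u v : V} {l : List E}
    (h : G.IsPath u l v) : t u + l.length ≤ t v := by
  induction l generalizing u with
  | nil => simp [show u = v from h]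
  | cons e l ih =>
    have h1 := ih h.2
    have h2 := ht e
    rw [h.1] at h2
    simp only [List.length_cons]
    omega

theorem IsPath.rank_tail (ht : ∀ e, t (G.tail e) < t (G.head e)) {u v : V} {l : List E}
    (h : G.IsPath u l v) {e : E} (he : e ∈ l) : t u ≤ t (G.tail e) := by
  obtain ⟨l₁, l₂, rfl⟩ := List.append_of_mem he
  have := (isPath_append_cons.1 h).1.rank_le ht
  omega

theorem IsPath.rank_head (ht : ∀ e, t (G.tail e) < t (G.head e)) {u v : V} {l : List E}
    (h : G.IsPath u l v) {e : E} (he : e ∈ l) : t (G.head e) ≤ t v := by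
  obtain ⟨l₁, l₂, rfl⟩ := List.append_of_mem he
  have := (isPath_append_cons.1 h).2.rank_le ht
  omega

theorem IsPath.eq_nil (ht : ∀ e, t (G.tail e) < t (G.head e)) {u : V} {l : List E}
    (h : G.IsPath u l u) : l = [] := by
  have := h.rank_le ht
  exact List.length_eq_zero_iff.1 (by omega)

theorem IsPath.nodup (ht : ∀ e, t (G.tail e) < t (G.head e)) {u v : V} {l : List E}
    (h : G.IsPath u l v) : l.Nodup := by
  induction l generalizing u with
  | nil => exact List.nodup_nil
  | cons e l ih =>
    refine List.nodup_cons.2 ⟨fun he => ?_, ih h.2⟩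
    have := IsPath.rank_tail ht h.2 he
    have := ht e
    omega

theorem IsPath.finish_unique {u u' v v' : V} {l : List E} (h : G.IsPath u l v)
    (h' : G.IsPath u' l v') (hl : l ≠ []) : v = v' := by
  rcases l.eq_nil_or_concat' with rfl | ⟨l, e, rfl⟩
  · exact absurd rfl hl
  · rw [← (isPath_concat.1 h).2, ← (isPath_concat.1 h').2]

/-- A path is cut in only one way at each of its vertices. -/
theorem IsPath.split_unique (ht : ∀ e, t (G.tail e) < t (G.head e)) {u v i : V}
    {l₁ l₂ m₁ m₂ : List E} (hl₁ : G.IsPath u l₁ i) (hl₂ : G.IsPath i l₂ v)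
    (hm₁ : G.IsPath u m₁ i) (hm₂ : G.IsPath i m₂ v) (h : l₁ ++ l₂ = m₁ ++ m₂) :
    l₁ = m₁ ∧ l₂ = m₂ := by
  have aux : ∀ {a n₁ n₂ : List E}, G.IsPath u (n₁ ++ a) i → G.IsPath i (a ++ n₂) v → a = [] := by
    intro a n₁ n₂ h1 h2
    by_contra ha
    obtain ⟨w, -, h3⟩ := isPath_append.1 h1
    obtain ⟨w', h4, -⟩ := isPath_append.1 h2
    obtain rfl := h3.finish_unique h4 ha
    exact ha (h4.eq_nil ht)
  rcases List.append_eq_append_iff.1 h with ⟨a, rfl, rfl⟩ | ⟨a, rfl, rfl⟩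
  · obtain rfl := aux hm₁ hl₂
    simp
  · obtain rfl := aux hl₁ hm₂
    simp

end Rank

/-! ### Routes -/

theorem Route.ext_edges {p q : G.Route} (hp : p.edges ≠ []) (h : p.edges = q.edges) : p = q := by
  have hf : p.finish = q.finish := by
    have := q.isPath
    rw [← h] at this
    exact p.isPath.finish_unique this hp
  have hs : p.start = q.start := by
    have h1 := p.isPath
    have h2 := q.isPath
    rw [← h] at h2
    cases hl : p.edges with
    | nil => exact absurd hl hp
    | cons e l =>
      rw [hl] at h1 h2
      rw [← h1.1, ← h2.1]
  exact Route.ext hs h hf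

theorem Route.finite [Finite V] [Finite E] (hG : G.IsAcyclic) : Finite G.Route := by
  obtain ⟨t, ht⟩ := hG.exists_rank
  have := Fintype.ofFinite E
  have : Finite {l : List E // l.Nodup} := Fintype.finite fintypeNodupList
  refine Finite.of_injective (β := V × {l : List E // l.Nodup} × V)
    (fun p => (p.start, ⟨p.edges, p.isPath.nodup ht⟩, p.finish)) fun p q h => ?_
  simp only [Prod.mk.injEq, Subtype.mk.injEq] at h
  exact Route.ext h.1 h.2.1 h.2.2

theorem Route.edges_ne_nil (hiso : ∀ v, G.IsSource v → ¬ G.IsSink v) (p : G.Route) :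
    p.edges ≠ [] := by
  intro h
  have := p.isPath
  rw [h] at this
  have h1 : p.start = p.finish := this
  exact hiso _ p.isSource (h1 ▸ p.isSink)

/-- A path repeats no edge. Counts, unlike indicators, are additive under concatenation, which is
what cutting and regluing routes needs. -/
theorem Route.indicator_eq_count {t : V → ℕ} (ht : ∀ e, t (G.tail e) < t (G.head e))
    (p : G.Route) (e : E) : p.indicator e = (p.edges.count e : ℝ) := by
  rw [(p.isPath.nodup ht).count]
  simp [Route.indicator]

/-- The netflow of a path. -/
theorem IsPath.netflow_count [Fintype E] {u v : V} {l : List E} (h : G.IsPath u l v) (x : V) :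
    (∑ e with G.tail e = x, (l.count e : ℝ)) - (∑ e with G.head e = x, (l.count e : ℝ)) =
      (if u = x then 1 else 0) - (if v = x then 1 else 0) := by
  induction l generalizing u with
  | nil => simp [show u = v from h]
  | cons f l ih =>
    have := ih h.2
    obtain ⟨rfl, -⟩ := h
    simp only [List.count_cons, Nat.cast_add, Finset.sum_add_distrib] at *
    simp only [beq_iff_eq, Nat.cast_ite, Nat.cast_one, Nat.cast_zero, Finset.sum_ite_eq,
      Finset.mem_filter, Finset.mem_univ, true_and]
    linarith

theorem Route.netflow [Fintype E] (hG : ∃ t : V → ℕ, ∀ e, t (G.tail e) < t (G.head e))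
    (p : G.Route) (x : V) :
    (∑ e with G.tail e = x, p.indicator e) - (∑ e with G.head e = x, p.indicator e) =
      (if p.start = x then 1 else 0) - (if p.finish = x then 1 else 0) := by
  obtain ⟨t, ht⟩ := hG
  simp only [p.indicator_eq_count ht]
  exact p.isPath.netflow_count x

/-! ### Comparison of paths, and additive heights that induce it -/

namespace Framing

variable (Φ : G.Framing)

theorem OutLT.tail_eq {Φ : G.Framing} {e f : E} (h : Φ.OutLT e f) : G.tail e = G.tail f := by
  obtain ⟨v, hv, he, hf, -⟩ := h
  rw [he, hf]

theorem InLT.head_eq {Φ : G.Framing} {e f : E} (h : Φ.InLT e f) : G.head e = G.head f := by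
  obtain ⟨v, hv, he, hf, -⟩ := h
  rw [he, hf]

theorem outLT_irrefl (e : E) : ¬ Φ.OutLT e e := by
  rintro ⟨v, hv, he, hf, h⟩
  let := Φ.outOrder v hv
  exact lt_irrefl _ h

theorem inLT_irrefl (e : E) : ¬ Φ.InLT e e := by
  rintro ⟨v, hv, he, hf, h⟩
  let := Φ.inOrder v hv
  exact lt_irrefl _ h

theorem OutLT.trans {Φ : G.Framing} {e f g : E} (h : Φ.OutLT e f) (h' : Φ.OutLT f g) :
    Φ.OutLT e g := by
  obtain ⟨v, hv, he, rfl, h⟩ := h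
  obtain ⟨v', hv', hf', hg, h'⟩ := h'
  subst hf'
  refine ⟨_, hv, he, hg, ?_⟩
  let := Φ.outOrder _ hv
  exact lt_trans h h'

theorem InLT.trans {Φ : G.Framing} {e f g : E} (h : Φ.InLT e f) (h' : Φ.InLT f g) :
    Φ.InLT e g := by
  obtain ⟨v, hv, he, rfl, h⟩ := h
  obtain ⟨v', hv', hf', hg, h'⟩ := h'
  subst hf'
  refine ⟨_, hv, he, hg, ?_⟩
  let := Φ.inOrder _ hv
  exact lt_trans h h'

theorem outLT_total {e f : E} (h : G.tail e = G.tail f) (hne : e ≠ f) :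
    Φ.OutLT e f ∨ Φ.OutLT f e := by
  let := Φ.outOrder _ (not_isSink_tail (G := G) f)
  rcases lt_trichotomy (⟨e, h⟩ : {g : E // G.tail g = G.tail f}) ⟨f, rfl⟩ with h1 | h1 | h1
  · exact Or.inl ⟨_, _, _, _, h1⟩
  · exact absurd (congrArg Subtype.val h1) hne
  · exact Or.inr ⟨_, _, _, _, h1⟩

theorem inLT_total {e f : E} (h : G.head e = G.head f) (hf : ¬ G.IsSink (G.head f))
    (hne : e ≠ f) : Φ.InLT e f ∨ Φ.InLT f e := by
  let := Φ.inOrder _ ⟨not_isSource_head (G := G) f, hf⟩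
  rcases lt_trichotomy (⟨e, h⟩ : {g : E // G.head g = G.head f}) ⟨f, rfl⟩ with h1 | h1 | h1
  · exact Or.inl ⟨_, _, _, _, h1⟩
  · exact absurd (congrArg Subtype.val h1) hne
  · exact Or.inr ⟨_, _, _, _, h1⟩

/-- Starting at sources prevents one path from being a proper final piece of the other. The end must
not be a sink because incoming edges are ordered only at internal vertices. -/
theorem preLT_total {u u' v : V} {l m : List E} (hl : G.IsPath u l v) (hm : G.IsPath u' m v)
    (hu : G.IsSource u) (hu' : G.IsSource u') (hv : ¬ G.IsSink v) (hne : l ≠ m) :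
    Φ.PreLT l m ∨ Φ.PreLT m l := by
  induction l using List.reverseRecOn generalizing v m with
  | nil =>
    exact absurd (hm.eq_nil_of_isSource ((show u = v from hl) ▸ hu)).symm hne
  | append_singleton l e ih =>
    rcases m.eq_nil_or_concat' with rfl | ⟨m, f, rfl⟩
    · exact absurd (hl.eq_nil_of_isSource ((show u' = v from hm) ▸ hu')) hne
    obtain ⟨hl, he⟩ := isPath_concat.1 hl
    obtain ⟨hm, hf⟩ := isPath_concat.1 hm
    by_cases hef : e = f
    · subst hef
      have := ih hl hm (not_isSink_tail _) (by rintro rfl; exact hne rfl)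
      refine this.imp ?_ ?_
      · rintro ⟨σ, l', m', f, g, rfl, rfl, h⟩
        exact ⟨σ ++ [e], l', m', f, g, by simp, by simp, h⟩
      · rintro ⟨σ, l', m', f, g, rfl, rfl, h⟩
        exact ⟨σ ++ [e], l', m', f, g, by simp, by simp, h⟩
    · refine (Φ.inLT_total (he.trans hf.symm) (hf ▸ hv) hef).imp ?_ ?_
      · exact fun h => ⟨[], l, m, e, f, rfl, rfl, h⟩
      · exact fun h => ⟨[], m, l, f, e, rfl, rfl, h⟩

theorem postLT_total {u v v' : V} {l m : List E} (hl : G.IsPath u l v) (hm : G.IsPath u m v')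
    (hv : G.IsSink v) (hv' : G.IsSink v') (hne : l ≠ m) :
    Φ.PostLT l m ∨ Φ.PostLT m l := by
  induction l generalizing u m with
  | nil =>
    exact absurd (hm.eq_nil_of_isSink ((show u = v from hl) ▸ hv)).symm hne
  | cons e l ih =>
    rcases m with _ | ⟨f, m⟩
    · exact absurd (hl.eq_nil_of_isSink ((show u = v' from hm) ▸ hv')) hne
    by_cases hef : e = f
    · subst hef
      have := ih hl.2 hm.2 (by rintro rfl; exact hne rfl)
      refine this.imp ?_ ?_
      · rintro ⟨σ, l', m', f, g, rfl, rfl, h⟩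
        exact ⟨e :: σ, l', m', f, g, by simp, by simp, h⟩
      · rintro ⟨σ, l', m', f, g, rfl, rfl, h⟩
        exact ⟨e :: σ, l', m', f, g, by simp, by simp, h⟩
    · refine (Φ.outLT_total (hl.1.trans hm.1.symm) hef).imp ?_ ?_
      · exact fun h => ⟨[], l, m, e, f, rfl, rfl, h⟩
      · exact fun h => ⟨[], m, l, f, e, rfl, rfl, h⟩

/-- The pre-orders at all vertices are induced by an additive height on edges. -/
theorem exists_preHeight [Fintype E] {t : V → ℕ} (ht : ∀ e, t (G.tail e) < t (G.head e)) :
    ∃ α : E → ℕ, ∀ (u u' v : V) (l m : List E), G.IsPath u l v → G.IsPath u' m v →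
      Φ.PreLT l m → (l.map α).sum < (m.map α).sum := by
  let ρ : E → ℕ := fun e => (Finset.univ.filter fun f => Φ.InLT f e).card
  let N := Fintype.card E
  have hρ : ∀ e, ρ e ≤ N := fun e => Finset.card_le_univ _
  have hρ' : ∀ e f, Φ.InLT e f → ρ e < ρ f := by
    intro e f h
    refine Finset.card_lt_card ⟨fun g hg => ?_, fun hs => ?_⟩
    · simp only [Finset.mem_filter, Finset.mem_univ, true_and] at hg ⊢
      exact hg.trans h
    · have := @hs e (by simpa using h)
      simp only [Finset.mem_filter, Finset.mem_univ, true_and] at this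
      exact Φ.inLT_irrefl _ this
  -- Positional notation in base `N + 1`: the digit `ρ e ≤ N` sits at the rank of the head of `e`.
  -- Ranks increase along a path, so the last differing edge outweighs everything before it.
  let α : E → ℕ := fun e => ρ e * (N + 1) ^ t (G.head e)
  have bound : ∀ (l : List E) (u v : V), G.IsPath u l v →
      (l.map α).sum + (N + 1) ^ (t u + 1) ≤ (N + 1) ^ (t v + 1) := by
    intro l
    induction l with
    | nil => intro u v h; simp [show u = v from h]
    | cons e l ih =>
      intro u v h
      have h1 := ih _ _ h.2
      obtain ⟨rfl, -⟩ := h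
      have h2 : (N + 1) ^ (t (G.tail e) + 1) ≤ (N + 1) ^ t (G.head e) :=
        Nat.pow_le_pow_right (by omega) (ht e)
      have h3 : ρ e * (N + 1) ^ t (G.head e) ≤ N * (N + 1) ^ t (G.head e) :=
        Nat.mul_le_mul_right _ (hρ e)
      have h4 : (N + 1) ^ (t (G.head e) + 1) = N * (N + 1) ^ t (G.head e) +
        (N + 1) ^ t (G.head e) := by ring
      simp only [List.map_cons, List.sum_cons]
      change ρ e * (N + 1) ^ t (G.head e) + _ + _ ≤ _
      omega
  refine ⟨α, ?_⟩
  rintro u u' v l m hl hm ⟨σ, l', m', f, g, rfl, rfl, h⟩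
  have h1 := bound _ _ _ (isPath_append_cons.1 hl).1
  have h2 : (N + 1) ^ (t (G.tail f) + 1) ≤ (N + 1) ^ t (G.head f) :=
    Nat.pow_le_pow_right (by omega) (ht f)
  have h3 : 0 < (N + 1) ^ (t u + 1) := by positivity
  have h4 : (ρ f + 1) * (N + 1) ^ t (G.head f) ≤ ρ g * (N + 1) ^ t (G.head f) :=
    Nat.mul_le_mul_right _ (hρ' _ _ h)
  have h5 : α g = ρ g * (N + 1) ^ t (G.head f) := by rw [h.head_eq]
  have h6 : α f = ρ f * (N + 1) ^ t (G.head f) := rfl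
  simp only [List.map_append, List.map_cons, List.sum_append, List.sum_cons]
  rw [add_mul, one_mul] at h4
  omega

/-- The post-orders at all vertices are induced by an additive height on edges. -/
theorem exists_postHeight [Fintype E] {t : V → ℕ} (ht : ∀ e, t (G.head e) < t (G.tail e)) :
    ∃ β : E → ℕ, ∀ (u v v' : V) (l m : List E), G.IsPath u l v → G.IsPath u m v' →
      Φ.PostLT l m → (l.map β).sum < (m.map β).sum := by
  let ρ : E → ℕ := fun e => (Finset.univ.filter fun f => Φ.OutLT f e).card
  let N := Fintype.card E
  have hρ : ∀ e, ρ e ≤ N := fun e => Finset.card_le_univ _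
  have hρ' : ∀ e f, Φ.OutLT e f → ρ e < ρ f := by
    intro e f h
    refine Finset.card_lt_card ⟨fun g hg => ?_, fun hs => ?_⟩
    · simp only [Finset.mem_filter, Finset.mem_univ, true_and] at hg ⊢
      exact hg.trans h
    · have := @hs e (by simpa using h)
      simp only [Finset.mem_filter, Finset.mem_univ, true_and] at this
      exact Φ.outLT_irrefl _ this
  -- The mirror image: `t` now decreases along edges, so the first differing edge carries the
  -- leading digit.
  let β : E → ℕ := fun e => ρ e * (N + 1) ^ t (G.tail e)
  have bound : ∀ (l : List E) (u v : V), G.IsPath u l v →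
      (l.map β).sum + (N + 1) ^ (t v + 1) ≤ (N + 1) ^ (t u + 1) := by
    intro l
    induction l with
    | nil => intro u v h; simp [show u = v from h]
    | cons e l ih =>
      intro u v h
      have h1 := ih _ _ h.2
      obtain ⟨rfl, -⟩ := h
      have h2 : (N + 1) ^ (t (G.head e) + 1) ≤ (N + 1) ^ t (G.tail e) :=
        Nat.pow_le_pow_right (by omega) (ht e)
      have h3 : ρ e * (N + 1) ^ t (G.tail e) ≤ N * (N + 1) ^ t (G.tail e) :=
        Nat.mul_le_mul_right _ (hρ e)
      have h4 : (N + 1) ^ (t (G.tail e) + 1) = N * (N + 1) ^ t (G.tail e) +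
        (N + 1) ^ t (G.tail e) := by ring
      simp only [List.map_cons, List.sum_cons]
      change ρ e * (N + 1) ^ t (G.tail e) + _ + _ ≤ _
      omega
  refine ⟨β, ?_⟩
  rintro u v v' l m hl hm ⟨σ, l', m', f, g, rfl, rfl, h⟩
  have h1 := bound _ _ _ (isPath_append_cons.1 hl).2
  have h2 : (N + 1) ^ (t (G.head f) + 1) ≤ (N + 1) ^ t (G.tail f) :=
    Nat.pow_le_pow_right (by omega) (ht f)
  have h3 : 0 < (N + 1) ^ (t v + 1) := by positivity
  have h4 : (ρ f + 1) * (N + 1) ^ t (G.tail f) ≤ ρ g * (N + 1) ^ t (G.tail f) :=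
    Nat.mul_le_mul_right _ (hρ' _ _ h)
  have h5 : β g = ρ g * (N + 1) ^ t (G.tail f) := by rw [h.tail_eq]
  have h6 : β f = ρ f * (N + 1) ^ t (G.tail f) := rfl
  simp only [List.map_append, List.map_cons, List.sum_append, List.sum_cons]
  rw [add_mul, one_mul] at h4
  omega

end Framing

end DirectedMultigraph

namespace DirectedMultigraph

variable {V E : Type*} {G : DirectedMultigraph V E}

/-! ### Existence of clique decompositions of flows -/

/-- The nonnegative functions on edges that are conserved at the internal vertices. -/
structure IsFlow [Fintype E] (G : DirectedMultigraph V E) (F : E → ℝ) : Prop where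
  nonneg : ∀ e, 0 ≤ F e
  conserved : ∀ v, G.IsInternal v → ∑ e with G.tail e = v, F e = ∑ e with G.head e = v, F e

/-- By conservation, positive flow out of an internal vertex forces positive flow into it, so one
can walk backwards. The bound `n` on the rank makes the walk stop, since rank `0` occurs only at
sources. -/
theorem IsFlow.exists_path_to [Fintype E] {t : V → ℕ} (ht : ∀ e, t (G.tail e) < t (G.head e))
    {F : E → ℝ} (hF : G.IsFlow F) (n : ℕ) (e : E) (hn : t (G.tail e) ≤ n) (he : 0 < F e) :
    ∃ s l, G.IsSource s ∧ G.IsPath s l (G.tail e) ∧ ∀ f ∈ l, 0 < F f := by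
  induction n generalizing e with
  | zero =>
    refine ⟨G.tail e, [], fun f hf => ?_, rfl, by simp⟩
    have := ht f
    rw [hf] at this
    omega
  | succ n ih =>
    by_cases hs : G.IsSource (G.tail e)
    · exact ⟨_, [], hs, rfl, by simp⟩
    have h1 : 0 < ∑ f with G.head f = G.tail e, F f := by
      rw [← hF.conserved _ ⟨hs, not_isSink_tail e⟩]
      exact Finset.sum_pos' (fun f _ => hF.nonneg f) ⟨e, by simp, he⟩
    obtain ⟨f, hf, hpos⟩ := Finset.exists_lt_of_sum_lt (f := fun _ => (0 : ℝ)) (by simpa using h1)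
    have hf : G.head f = G.tail e := by simpa using hf
    have := ht f
    obtain ⟨s, l, hs, hl, hlp⟩ := ih f (by rw [hf] at this; omega) hpos
    refine ⟨s, l ++ [f], hs, isPath_concat.2 ⟨hl, hf⟩, ?_⟩
    intro g hg
    rcases List.mem_append.1 hg with hg | hg
    · exact hlp g hg
    · rw [List.mem_singleton.1 hg]
      exact hpos

theorem IsFlow.exists_path_from [Fintype E] {t : V → ℕ} (ht : ∀ e, t (G.head e) < t (G.tail e))
    {F : E → ℝ} (hF : G.IsFlow F) (n : ℕ) (e : E) (hn : t (G.head e) ≤ n) (he : 0 < F e) :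
    ∃ j l, G.IsSink j ∧ G.IsPath (G.head e) l j ∧ ∀ f ∈ l, 0 < F f := by
  induction n generalizing e with
  | zero =>
    refine ⟨G.head e, [], fun f hf => ?_, rfl, by simp⟩
    have := ht f
    rw [hf] at this
    omega
  | succ n ih =>
    by_cases hs : G.IsSink (G.head e)
    · exact ⟨_, [], hs, rfl, by simp⟩
    have h1 : 0 < ∑ f with G.tail f = G.head e, F f := by
      rw [hF.conserved _ ⟨not_isSource_head e, hs⟩]
      exact Finset.sum_pos' (fun f _ => hF.nonneg f) ⟨e, by simp, he⟩
    obtain ⟨f, hf, hpos⟩ := Finset.exists_lt_of_sum_lt (f := fun _ => (0 : ℝ)) (by simpa using h1)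
    have hf : G.tail f = G.head e := by simpa using hf
    have := ht f
    obtain ⟨j, l, hj, hl, hlp⟩ := ih f (by rw [hf] at this; omega) hpos
    refine ⟨j, f :: l, hj, ⟨hf, hl⟩, ?_⟩
    intro g hg
    rcases List.mem_cons.1 hg with rfl | hg
    · exact hpos
    · exact hlp g hg

theorem IsAcyclic.exists_corank [Finite V] (hG : G.IsAcyclic) :
    ∃ t : V → ℕ, ∀ e, t (G.head e) < t (G.tail e) := by
  obtain ⟨t, ht⟩ := hG.exists_rank
  obtain ⟨T, hT⟩ := (Set.finite_range t).bddAbove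
  refine ⟨fun v => T - t v, fun e => ?_⟩
  have h1 := ht e
  have h2 : t (G.head e) ≤ T := hT ⟨_, rfl⟩
  change T - _ < T - _
  omega

/-- Every edge with positive flow lies on a route with positive flow. -/
theorem IsFlow.exists_route [Finite V] [Fintype E] (hG : G.IsAcyclic) {F : E → ℝ}
    (hF : G.IsFlow F) {e : E} (he : 0 < F e) :
    ∃ p : G.Route, ∀ f ∈ p.edges, 0 < F f := by
  obtain ⟨t, ht⟩ := hG.exists_rank
  obtain ⟨t', ht'⟩ := hG.exists_corank
  obtain ⟨s, l, hs, hl, hlp⟩ := hF.exists_path_to ht _ e le_rfl he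
  obtain ⟨j, m, hj, hm, hmp⟩ := hF.exists_path_from ht' _ e le_rfl he
  refine ⟨⟨s, l ++ e :: m, j, hs, hj, isPath_append_cons.2 ⟨hl, hm⟩⟩, fun f hf => ?_⟩
  rcases List.mem_append.1 hf with hf | hf
  · exact hlp f hf
  rcases List.mem_cons.1 hf with rfl | hf
  · exact he
  · exact hmp f hf

/-- The sum of the products `α e * β f` over all pairs of list entries with `e` before `f`. -/
def pairSum (α β : E → ℕ) : List E → ℕ
  | [] => 0
  | e :: l => α e * (l.map β).sum + pairSum α β l

/-- Of these three terms only the middle product feels how initial and final pieces of routes are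
paired. -/
theorem pairSum_append (α β : E → ℕ) (l m : List E) :
    pairSum α β (l ++ m) = pairSum α β l + (l.map α).sum * (m.map β).sum + pairSum α β m := by
  induction l with
  | nil => simp [pairSum]
  | cons e l ih =>
    simp only [List.cons_append, pairSum, ih, List.map_append, List.sum_append, List.map_cons,
      List.sum_cons]
    ring

theorem IsFlow.sub_routes [Fintype E] [Fintype G.Route]
    (hG : ∃ t : V → ℕ, ∀ e, t (G.tail e) < t (G.head e)) {F : E → ℝ}
    (hF : G.IsFlow F) {c : G.Route → ℝ} (hc : ∀ e, ∑ p, c p * p.indicator e ≤ F e) :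
    G.IsFlow fun e => F e - ∑ p, c p * p.indicator e := by
  refine ⟨fun e => sub_nonneg.2 (hc e), fun v hv => ?_⟩
  have key : ∀ p : G.Route, (∑ e with G.tail e = v, p.indicator e) =
      ∑ e with G.head e = v, p.indicator e := by
    intro p
    have h1 : p.start ≠ v := by rintro rfl; exact hv.1 p.isSource
    have h2 : p.finish ≠ v := by rintro rfl; exact hv.2 p.isSink
    have := p.netflow hG v
    simp only [h1, h2, if_false, sub_self] at this
    linarith
  rw [Finset.sum_sub_distrib, Finset.sum_sub_distrib, hF.conserved v hv, Finset.sum_comm,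
    Finset.sum_comm (s := Finset.univ.filter fun e => G.head e = v)]
  simp only [← Finset.mul_sum, key]

theorem Route.indicator_nonneg (p : G.Route) (e : E) : 0 ≤ p.indicator e := by
  unfold Route.indicator
  split_ifs <;> simp

theorem Route.indicator_of_mem {p : G.Route} {e : E} (h : e ∈ p.edges) : p.indicator e = 1 := by
  simp [Route.indicator, h]

theorem Route.indicator_of_notMem {p : G.Route} {e : E} (h : e ∉ p.edges) : p.indicator e = 0 := by
  simp [Route.indicator, h]

/-- A sub-decomposition of maximal weight. -/
theorem exists_max_decomposition [Fintype E] [Fintype G.Route]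
    (hne : ∀ p : G.Route, p.edges ≠ []) {F : E → ℝ} (hF : ∀ e, 0 ≤ F e) (w : G.Route → ℝ) :
    ∃ c : G.Route → ℝ, (∀ p, 0 ≤ c p) ∧ (∀ e, ∑ p, c p * p.indicator e ≤ F e) ∧
      ∀ c' : G.Route → ℝ, (∀ p, 0 ≤ c' p) → (∀ e, ∑ p, c' p * p.indicator e ≤ F e) →
        ∑ p, c' p * w p ≤ ∑ p, c p * w p := by
  let S : Set (G.Route → ℝ) := {c | (∀ p, 0 ≤ c p) ∧ ∀ e, ∑ p, c p * p.indicator e ≤ F e}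
  have hclosed : IsClosed S := by
    have : S = (⋂ p, {c | 0 ≤ c p}) ∩ ⋂ e, {c | ∑ p, c p * p.indicator e ≤ F e} := by
      ext c
      simp [S]
    rw [this]
    refine IsClosed.inter (isClosed_iInter fun p => ?_) (isClosed_iInter fun e => ?_)
    · exact isClosed_le continuous_const (continuous_apply p)
    · exact isClosed_le (by fun_prop) continuous_const
  -- Every route has an edge, and the flow on that edge bounds its coefficient.
  have hsub : S ⊆ Set.Icc 0 fun _ => ∑ e, F e := by
    rintro c ⟨h0, h1⟩
    refine ⟨h0, fun p => ?_⟩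
    obtain ⟨e, he⟩ := List.exists_mem_of_ne_nil _ (hne p)
    calc c p = c p * p.indicator e := by rw [Route.indicator_of_mem he, mul_one]
      _ ≤ ∑ q, c q * q.indicator e :=
        Finset.single_le_sum (f := fun q : G.Route => c q * q.indicator e)
          (fun q _ => mul_nonneg (h0 q) (q.indicator_nonneg e)) (Finset.mem_univ p)
      _ ≤ F e := h1 e
      _ ≤ ∑ e, F e := Finset.single_le_sum (fun e _ => hF e) (Finset.mem_univ e)
  have hcomp : IsCompact S := isCompact_Icc.of_isClosed_subset hclosed hsub
  obtain ⟨c, hc, hmax⟩ := hcomp.exists_isMaxOn ⟨0, by simp, by simpa using hF⟩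
    (f := fun c => ∑ p, c p * w p) (by fun_prop)
  exact ⟨c, hc.1, hc.2, fun c' h0 h1 => hmax ⟨h0, h1⟩⟩

theorem sum_add_single {ι : Type*} [Fintype ι] (c : ι → ℝ) (x : ℝ) (i : ι) (w : ι → ℝ) :
    ∑ j, (c + Pi.single i x : ι → ℝ) j * w j = ∑ j, c j * w j + x * w i := by
  simp [add_mul, Finset.sum_add_distrib, Pi.single_apply]

/-- Every flow is a nonnegative combination of the routes of a clique. -/
theorem IsFlow.exists_decomposition [Fintype V] [Fintype E] [Fintype G.Route] (hG : G.IsAcyclic)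
    (hiso : ∀ v, G.IsSource v → ¬ G.IsSink v) (Φ : G.Framing) {F : E → ℝ} (hF : G.IsFlow F) :
    ∃ c : G.Route → ℝ, (∀ p, 0 ≤ c p) ∧ Φ.IsRouteClique {p | c p ≠ 0} ∧
      ∀ e, ∑ p, c p * p.indicator e = F e := by
  obtain ⟨t, ht⟩ := hG.exists_rank
  obtain ⟨t', ht'⟩ := hG.exists_corank
  obtain ⟨α, hα⟩ := Φ.exists_preHeight ht
  obtain ⟨β, hβ⟩ := Φ.exists_postHeight ht'
  -- The summand `1` makes adding any route profitable, so that a maximum exhausts the flow;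
  -- `pairSum` makes resolving an incompatibility profitable.
  let w : G.Route → ℝ := fun p => 1 + pairSum α β p.edges
  have hw : ∀ p, 0 < w p := fun p => by positivity
  obtain ⟨c, h0, h1, hmax⟩ := exists_max_decomposition (Route.edges_ne_nil hiso) hF.nonneg w
  refine ⟨c, h0, ?_, ?_⟩
  · have swap : ∀ p q : G.Route, ∀ i p₁ p₂ q₁ q₂, c p ≠ 0 → c q ≠ 0 → p.SplitsAt i p₁ p₂ →
        q.SplitsAt i q₁ q₂ → Φ.PreLT p₁ q₁ → Φ.PostLT q₂ p₂ → False := by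
      intro p q i p₁ p₂ q₁ q₂ hp hq ⟨hpe, hp₁, hp₂⟩ ⟨hqe, hq₁, hq₂⟩ hpre hpost
      let p' : G.Route := ⟨p.start, p₁ ++ q₂, q.finish, p.isSource, q.isSink,
        isPath_append.2 ⟨_, hp₁, hq₂⟩⟩
      let q' : G.Route := ⟨q.start, q₁ ++ p₂, p.finish, q.isSource, p.isSink,
        isPath_append.2 ⟨_, hq₁, hp₂⟩⟩
      have hα' := hα _ _ _ _ _ hp₁ hq₁ hpre
      have hβ' := hβ _ _ _ _ _ hq₂ hp₂ hpost
      have hpq : p ≠ q := by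
        rintro rfl
        have := (IsPath.split_unique ht hp₁ hp₂ hq₁ hq₂ (hpe.symm.trans hqe)).1
        rw [this] at hα'
        exact lt_irrefl _ hα'
      -- The largest amount that can be moved from `p`, `q` to the reglued routes `p'`, `q'` while
      -- all coefficients stay nonnegative.
      let ε := min (c p) (c q)
      have hε : 0 < ε := lt_min ((h0 p).lt_of_ne' hp) ((h0 q).lt_of_ne' hq)
      let c' := c + Pi.single p (-ε) + Pi.single q (-ε) + Pi.single p' ε + Pi.single q' ε
      have hc' : ∀ x : G.Route → ℝ,
          ∑ r, c' r * x r = ∑ r, c r * x r + ε * (x p' + x q' - x p - x q) := by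
        intro x
        simp only [c', sum_add_single]
        ring
      have hmax' := hmax c' ?_ ?_
      · rw [hc'] at hmax'
        have : (pairSum α β p.edges + pairSum α β q.edges : ℝ) <
            pairSum α β p'.edges + pairSum α β q'.edges := by
          -- Rearrangement inequality: the gain is the product of the positive differences `hα'` and
          -- `hβ'` of the heights before and after `i`.
          have : pairSum α β p.edges + pairSum α β q.edges <
            pairSum α β p'.edges + pairSum α β q'.edges := by
            rw [hpe, hqe, pairSum_append, pairSum_append]
            simp only [p', q', pairSum_append]
            nlinarith
          exact_mod_cast this
        have h3 : 0 < w p' + w q' - w p - w q := by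
          simp only [w]
          linarith
        nlinarith [mul_pos hε h3]
      · intro r
        have e1 : 0 ≤ (Pi.single p' ε : G.Route → ℝ) r := by
          rw [Pi.single_apply]; split_ifs <;> linarith
        have e2 : 0 ≤ (Pi.single q' ε : G.Route → ℝ) r := by
          rw [Pi.single_apply]; split_ifs <;> linarith
        have e3 : 0 ≤ (c + Pi.single p (-ε) + Pi.single q (-ε) : G.Route → ℝ) r := by
          simp only [Pi.add_apply, Pi.single_apply]
          have := h0 r
          by_cases hrp : r = p
          · subst hrp
            rw [if_pos rfl, if_neg hpq]
            linarith [min_le_left (c r) (c q)]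
          · rw [if_neg hrp]
            by_cases hrq : r = q
            · subst hrq
              rw [if_pos rfl]
              linarith [min_le_right (c p) (c r)]
            · rw [if_neg hrq]
              linarith
        simp only [c', Pi.add_apply] at e3 ⊢
        linarith
      · intro e
        rw [hc' fun r => r.indicator e]
        have : p'.indicator e + q'.indicator e - p.indicator e - q.indicator e = 0 := by
          simp only [Route.indicator_eq_count ht, hpe, hqe, p', q', List.count_append,
            Nat.cast_add]
          ring
        simpa [this] using h1 e
    rintro p hp q hq i ⟨p₁, p₂, q₁, q₂, hps, hqs, h | h⟩
    · exact swap p q i p₁ p₂ q₁ q₂ hp hq hps hqs h.1 h.2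
    · exact swap q p i q₁ q₂ p₁ p₂ hq hp hqs hps h.1 h.2
  -- The remainder is again a flow. If it is nonzero it is positive along a whole route, and adding
  -- that route, with its bottleneck value as coefficient, increases the weight.
  · by_contra hcon
    push Not at hcon
    obtain ⟨e, he⟩ := hcon
    have hR := hF.sub_routes ⟨t, ht⟩ h1
    obtain ⟨p, hp⟩ := hR.exists_route hG (sub_pos.2 ((h1 e).lt_of_ne he))
    obtain ⟨f, hf, hmin⟩ := p.edges.toFinset.exists_min_image
      (fun e => F e - ∑ p, c p * p.indicator e)
      (by simpa [Finset.Nonempty] using List.exists_mem_of_ne_nil _ (Route.edges_ne_nil hiso p))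
    have hfpos := hp f (by simpa using hf)
    have := hmax (c + Pi.single p (F f - ∑ p, c p * p.indicator f)) ?_ ?_
    · rw [sum_add_single] at this
      nlinarith [mul_pos hfpos (hw p)]
    · intro r
      have := h0 r
      rw [Pi.add_apply, Pi.single_apply]
      split_ifs <;> linarith
    · intro e
      rw [sum_add_single]
      by_cases hep : e ∈ p.edges
      · have := hmin e (by simpa using hep)
        rw [Route.indicator_of_mem hep]
        linarith
      · rw [Route.indicator_of_notMem hep, mul_zero, add_zero]
        exact h1 e

end DirectedMultigraph

namespace DirectedMultigraph

variable {V E : Type*} {G : DirectedMultigraph V E}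

/-! ### Uniqueness of clique decompositions -/

/-- The total weight of a set. -/
def weight {ι : Type*} [Fintype ι] (c : ι → ℝ) (S : Set ι) : ℝ := ∑ i, S.indicator c i

section Weight

variable {ι : Type*} [Fintype ι] {c : ι → ℝ}

theorem weight_union {S T : Set ι} (h : Disjoint S T) :
    weight c (S ∪ T) = weight c S + weight c T := by
  simp only [weight, Set.indicator_union_of_disjoint h, Finset.sum_add_distrib]

theorem weight_empty : weight c ∅ = 0 := by simp [weight]

theorem weight_singleton (i : ι) : weight c {i} = c i := by
  simp [weight, Set.indicator_apply]

theorem weight_mono_of_support (h0 : ∀ i, 0 ≤ c i) {S T : Set ι}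
    (h : ∀ i ∈ S, c i ≠ 0 → i ∈ T) : weight c S ≤ weight c T := by
  refine Finset.sum_le_sum fun i _ => ?_
  by_cases hS : i ∈ S
  · by_cases hc : c i = 0
    · simp [Set.indicator_apply, hc]
    · simp [hS, h i hS hc]
  · rw [Set.indicator_of_notMem hS]
    exact Set.indicator_nonneg (fun i _ => h0 i) i

theorem weight_congr_of_support {S T : Set ι} (h : ∀ i, c i ≠ 0 → (i ∈ S ↔ i ∈ T)) :
    weight c S = weight c T := by
  refine Finset.sum_congr rfl fun i _ => ?_
  by_cases hc : c i = 0
  · simp [Set.indicator_apply, hc]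
  · simp [Set.indicator_apply, h i hc]

/-- The weight of the intersection of two sets that are nested on the support. -/
theorem weight_inter_eq_min (h0 : ∀ i, 0 ≤ c i) {S T : Set ι}
    (h : ∀ i j, c i ≠ 0 → c j ≠ 0 → i ∈ S → i ∉ T → j ∈ T → j ∉ S → False) :
    weight c (S ∩ T) = min (weight c S) (weight c T) := by
  by_cases hST : ∀ i ∈ S, c i ≠ 0 → i ∈ T
  · rw [min_eq_left (weight_mono_of_support h0 hST)]
    exact weight_congr_of_support fun i hi => ⟨fun h => h.1, fun h => ⟨h, hST i h hi⟩⟩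
  · push Not at hST
    obtain ⟨i, hiS, hi, hiT⟩ := hST
    have hTS : ∀ j ∈ T, c j ≠ 0 → j ∈ S := fun j hj hc => by
      by_contra hjS
      exact h i j hi hc hiS hiT hj hjS
    rw [min_eq_right (weight_mono_of_support h0 hTS)]
    exact weight_congr_of_support fun i hi => ⟨fun h => h.2, fun h => ⟨hTS i h hi, h⟩⟩

end Weight

/-- Lets the flow through edges leaving one vertex be read as a weight of routes: no route is
counted twice. -/
theorem IsPath.eq_of_tail_eq {t : V → ℕ} (ht : ∀ e, t (G.tail e) < t (G.head e)) {u v : V}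
    {l : List E} (h : G.IsPath u l v) {e f : E} (he : e ∈ l) (hf : f ∈ l)
    (hef : G.tail e = G.tail f) : e = f := by
  obtain ⟨l₁, l₂, rfl⟩ := List.append_of_mem he
  obtain ⟨h1, h2⟩ := isPath_append_cons.1 h
  rcases List.mem_append.1 hf with hf | hf
  · have := h1.rank_head ht hf
    have := ht f
    rw [← hef] at this
    omega
  rcases List.mem_cons.1 hf with rfl | hf
  · rfl
  · have := h2.rank_tail ht hf
    have := ht e
    rw [← hef] at *
    omega

theorem IsPath.eq_of_head_eq {t : V → ℕ} (ht : ∀ e, t (G.tail e) < t (G.head e)) {u v : V}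
    {l : List E} (h : G.IsPath u l v) {e f : E} (he : e ∈ l) (hf : f ∈ l)
    (hef : G.head e = G.head f) : e = f := by
  obtain ⟨l₁, l₂, rfl⟩ := List.append_of_mem he
  obtain ⟨h1, h2⟩ := isPath_append_cons.1 h
  rcases List.mem_append.1 hf with hf | hf
  · have := h1.rank_head ht hf
    have := ht e
    rw [hef] at this
    omega
  rcases List.mem_cons.1 hf with rfl | hf
  · rfl
  · have := h2.rank_tail ht hf
    have := ht f
    rw [← hef] at *
    omega

/-- The flow through a set of edges of which no route uses two. -/
theorem sum_flow_eq_weight [Fintype E] [Fintype G.Route] {c : G.Route → ℝ} {F : E → ℝ}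
    (hc : ∀ e, ∑ p, c p * p.indicator e = F e) {P : E → Prop}
    [DecidablePred P] (hP : ∀ p : G.Route, ∀ e ∈ p.edges, ∀ f ∈ p.edges, P e → P f → e = f) :
    ∑ e with P e, F e = weight c {p : G.Route | ∃ e ∈ p.edges, P e} := by
  simp only [← hc]
  rw [Finset.sum_comm]
  refine Finset.sum_congr rfl fun p _ => ?_
  rw [← Finset.mul_sum]
  by_cases h : ∃ e ∈ p.edges, P e
  · rw [Set.indicator_of_mem (by exact h)]
    obtain ⟨e, he, hPe⟩ := h
    rw [Finset.sum_eq_single e, Route.indicator_of_mem he, mul_one]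
    · intro f hf hfe
      refine Route.indicator_of_notMem fun hfp => hfe ?_
      exact hP p f hfp e he (by simpa using hf) hPe
    · simp [hPe]
  · rw [Set.indicator_of_notMem (by exact h), Finset.sum_eq_zero, mul_zero]
    intro f hf
    refine Route.indicator_of_notMem fun hfp => h ⟨f, hfp, by simpa using hf⟩

/-! ### The coefficients of a clique decomposition as functions of the flow -/

namespace Framing

variable (Φ : G.Framing)

/-- How many of the `x` lowest units of flow at the tail of `e` continue along `e`. -/
def share [Fintype E] (F : E → ℝ) (e : E) (x : ℝ) : ℝ :=
  min x (∑ f with Φ.OutLT f e ∨ f = e, F f) - min x (∑ f with Φ.OutLT f e, F f)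

/-- The position at the head of `e` of the unit of flow of position `x` at its tail. -/
def transport [Fintype E] (F : E → ℝ) (x : ℝ) (e : E) : ℝ :=
  ∑ f with Φ.InLT f e, F f + Φ.share F e x

/-- The coefficient of a route in the clique decomposition of a flow. -/
def coefficient [Fintype E] (F : E → ℝ) (p : G.Route) : ℝ :=
  p.edges.foldl (Φ.transport F) (∑ e with G.tail e = p.start, F e) -
    p.edges.foldl (Φ.transport F) 0

/-- Only sums, differences and minima occur in the formula, and a minimum is one of its arguments.
With the integers as `H`, this is the source of unimodularity. -/
theorem coefficient_mem [Fintype E] {F : E → ℝ} {H : AddSubgroup ℝ} (hF : ∀ e, F e ∈ H)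
    (p : G.Route) : Φ.coefficient F p ∈ H := by
  have hmin : ∀ x ∈ H, ∀ y ∈ H, min x y ∈ H := by
    intro x hx y hy
    rcases min_choice x y with h | h <;> rw [h] <;> assumption
  have hsum : ∀ s : Finset E, ∑ e ∈ s, F e ∈ H := fun s => H.sum_mem fun e _ => hF e
  have hfold : ∀ (l : List E) (x : ℝ), x ∈ H → l.foldl (Φ.transport F) x ∈ H := by
    intro l
    induction l with
    | nil => exact fun x hx => hx
    | cons e l ih =>
      intro x hx
      exact ih _ (H.add_mem (hsum _) (H.sub_mem (hmin _ hx _ (hsum _)) (hmin _ hx _ (hsum _))))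
  exact H.sub_mem (hfold _ _ (hsum _)) (hfold _ _ H.zero_mem)

variable {Φ}

/-- The routes through `v` whose height before `v` is in relation `r` to that of `π`. -/
def lowerRoutes (G : DirectedMultigraph V E) (α : E → ℕ) (r : ℕ → ℕ → Prop) (π : List E) (v : V) :
    Set G.Route :=
  {p | ∃ p₁ p₂, p.SplitsAt v p₁ p₂ ∧ r (p₁.map α).sum (π.map α).sum}

section Coefficient

variable [Fintype E] [Fintype G.Route] {t : V → ℕ}
  (ht : ∀ e, t (G.tail e) < t (G.head e)) {α : E → ℕ}
  (hα : ∀ (u u' v : V) (l m : List E), G.IsPath u l v → G.IsPath u' m v →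
      Φ.PreLT l m → (l.map α).sum < (m.map α).sum) {c : G.Route → ℝ} (h0 : ∀ p, 0 ≤ c p)
  (hclique : Φ.IsRouteClique {p | c p ≠ 0}) {F : E → ℝ}
  (hc : ∀ e, ∑ p, c p * p.indicator e = F e)
  {r : ℕ → ℕ → Prop} (hlt : ∀ {a b}, a < b → r a b) (hle : ∀ {a b}, r a b → a ≤ b)
  (hadd : ∀ {a b d}, r (a + d) (b + d) ↔ r a b)

include ht hα h0 hclique hc hlt hle

/-- In a clique, the routes arriving low at the tail of `e` and the routes leaving through a lower
set of edges are nested, so the weight of their intersection is a minimum. Subtracting this for the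
edges below `e` from the same for the edges up to `e` leaves `share`. The relation `r` stands for
both `≤` and `<`. -/
theorem weight_lowerRoutes_edge (π : List E) (e : E) :
    weight c {p | ∃ ρ τ, p.edges = ρ ++ e :: τ ∧ r (ρ.map α).sum (π.map α).sum} =
      Φ.share F e (weight c (lowerRoutes G α r π (G.tail e))) := by
  have hO : ∑ f with Φ.OutLT f e, F f = weight c {p | ∃ f ∈ p.edges, Φ.OutLT f e} :=
    sum_flow_eq_weight hc fun p f hf g hg h h' =>
      p.isPath.eq_of_tail_eq ht hf hg (h.tail_eq.trans h'.tail_eq.symm)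
  have htail : ∀ {f}, Φ.OutLT f e ∨ f = e → G.tail f = G.tail e := by
    rintro f (h | rfl)
    · exact h.tail_eq
    · rfl
  have hO' : ∑ f with Φ.OutLT f e ∨ f = e, F f =
      weight c {p | ∃ f ∈ p.edges, Φ.OutLT f e ∨ f = e} :=
    sum_flow_eq_weight hc fun p f hf g hg h h' =>
      p.isPath.eq_of_tail_eq ht hf hg ((htail h).trans (htail h').symm)
  have hsplit : ∀ {p : G.Route} {f p₁ p₂}, f ∈ p.edges → G.tail f = G.tail e →
      p.SplitsAt (G.tail e) p₁ p₂ → ∃ τ, p₂ = f :: τ ∧ G.IsPath (G.tail e) (f :: τ) p.finish := by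
    rintro p f p₁ p₂ hf hfe ⟨h1, h2, h3⟩
    obtain ⟨l₁, l₂, h4⟩ := List.append_of_mem hf
    have hp := p.isPath
    rw [h4] at hp
    have h5 := isPath_append_cons.1 hp
    obtain ⟨-, rfl⟩ := IsPath.split_unique ht h2 h3 (hfe ▸ h5.1)
      (show G.IsPath _ (f :: l₂) _ from ⟨hfe, h5.2⟩)
      (h1.symm.trans h4)
    exact ⟨l₂, rfl, h3⟩
  -- A failure of nesting gives `p` arriving below `q` but leaving above it, which is an
  -- incompatibility.
  have hnest : ∀ P : E → Prop, (∀ f, P f → G.tail f = G.tail e) →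
      (∀ f g, Φ.OutLT f g → P g → P f) →
      ∀ p q, c p ≠ 0 → c q ≠ 0 → p ∈ lowerRoutes G α r π (G.tail e) →
        p ∉ {p : G.Route | ∃ f ∈ p.edges, P f} → q ∈ {p : G.Route | ∃ f ∈ p.edges, P f} →
        q ∉ lowerRoutes G α r π (G.tail e) → False := by
    rintro P hP hPlt p q hp hq ⟨p₁, p₂, hps, hr⟩ hpP ⟨g, hgq, hPg⟩ hqr
    obtain ⟨q₁, q₂, hqe⟩ := List.append_of_mem hgq
    have hqp := q.isPath
    rw [hqe] at hqp
    have h5 := isPath_append_cons.1 hqp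
    have hqs : q.SplitsAt (G.tail e) q₁ (g :: q₂) := by
      refine ⟨hqe, ?_, hP g hPg, h5.2⟩
      rw [← hP g hPg]
      exact h5.1
    have hqr' : ¬ r (q₁.map α).sum (π.map α).sum := fun h => hqr ⟨_, _, hqs, h⟩
    have hlt' : (p₁.map α).sum < (q₁.map α).sum := by
      have h1 := hle hr
      have h2 : ¬ (q₁.map α).sum < (π.map α).sum := fun h => hqr' (hlt h)
      refine lt_of_le_of_ne (by omega) fun h => hqr' (h ▸ hr)
    have hpre : Φ.PreLT p₁ q₁ := by
      refine (Φ.preLT_total hps.2.1 hqs.2.1 p.isSource q.isSource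
        (not_isSink_tail e) ?_).resolve_right
        fun h => ?_
      · rintro rfl
        exact lt_irrefl _ hlt'
      · exact lt_asymm hlt' (hα _ _ _ _ _ hqs.2.1 hps.2.1 h)
    have hpost : Φ.PostLT (g :: q₂) p₂ := by
      cases p₂ with
      | nil =>
        have h6 : G.tail e = p.finish := hps.2.2
        exact absurd (h6 ▸ p.isSink) (not_isSink_tail e)
      | cons f τ =>
        have hfp : f ∈ p.edges := by simp [hps.1]
        have hne : ¬ P f := fun h => hpP ⟨f, hfp, h⟩
        have hgf : g ≠ f := by
          rintro rfl
          exact hne hPg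
        refine ⟨[], q₂, τ, g, f, rfl, rfl, ?_⟩
        exact (Φ.outLT_total ((hP g hPg).trans hps.2.2.1.symm) hgf).resolve_right
          fun h => hne (hPlt _ _ h hPg)
    exact hclique p hp q hq _ ⟨p₁, p₂, q₁, g :: q₂, hps, hqs, Or.inl ⟨hpre, hpost⟩⟩
  have h1 := weight_inter_eq_min h0 (hnest (fun f => Φ.OutLT f e) (fun f h => h.tail_eq)
    fun f g h h' => h.trans h')
  have h2 := weight_inter_eq_min h0 (hnest (fun f => Φ.OutLT f e ∨ f = e) (fun f h => htail h)
    fun f g h h' => h'.elim (fun h' => Or.inl (h.trans h')) fun h' => Or.inl (h' ▸ h))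
  rw [share, hO, hO', ← h1, ← h2, eq_sub_iff_add_eq, ← weight_union]
  · congr 1
    ext p
    constructor
    · rintro (⟨ρ, τ, hp, hr⟩ | ⟨h, f, hf, hfe⟩)
      · have hpp := p.isPath
        rw [hp] at hpp
        have h5 := isPath_append_cons.1 hpp
        exact ⟨⟨ρ, e :: τ, ⟨hp, h5.1, rfl, h5.2⟩, hr⟩, e, by simp [hp], Or.inr rfl⟩
      · exact ⟨h, f, hf, Or.inl hfe⟩
    · rintro ⟨h, f, hf, hfe | rfl⟩
      · exact Or.inr ⟨h, f, hf, hfe⟩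
      · obtain ⟨p₁, p₂, hs, hr⟩ := h
        obtain ⟨τ, rfl, -⟩ := hsplit hf rfl hs
        exact Or.inl ⟨p₁, τ, hs.1, hr⟩
  · rw [Set.disjoint_left]
    rintro p ⟨ρ, τ, hp, hr⟩ ⟨h, f, hf, hfe⟩
    obtain rfl := p.isPath.eq_of_tail_eq ht hf (show e ∈ p.edges by simp [hp]) hfe.tail_eq
    exact Φ.outLT_irrefl _ hfe

include hadd

/-- At the head of the last edge `e` of the path, the lower routes are those entering by a smaller
edge, all of them, and those entering by `e` that were already lower at its tail. This is the
recursion of `transport`. -/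
theorem weight_lowerRoutes {s v : V} {π : List E} (hπ : G.IsPath s π v)
    (hv : ¬ G.IsSink v) :
    weight c (lowerRoutes G α r π v) =
      π.foldl (Φ.transport F) (weight c (lowerRoutes G α r [] s)) := by
  induction π using List.reverseRecOn generalizing v with
  | nil => rw [show s = v from hπ]; rfl
  | append_singleton π e ih =>
    obtain ⟨hπ', rfl⟩ := isPath_concat.1 hπ
    clear hπ
    rename' hπ' => hπ
    rw [List.foldl_append, ← ih hπ (not_isSink_tail e)]
    simp only [List.foldl_cons, List.foldl_nil, transport]
    have hI : ∑ f with Φ.InLT f e, F f = weight c {p | ∃ f ∈ p.edges, Φ.InLT f e} :=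
      sum_flow_eq_weight hc fun p f hf g hg h h' =>
        p.isPath.eq_of_head_eq ht hf hg (h.head_eq.trans h'.head_eq.symm)
    rw [hI, ← weight_lowerRoutes_edge ht hα h0 hclique hc hlt hle, ← weight_union]
    · congr 1
      ext p
      constructor
      · rintro ⟨p₁, p₂, hp, hr⟩
        rcases p₁.eq_nil_or_concat' with rfl | ⟨ρ, f, rfl⟩
        · have h1 : p.start = G.head e := hp.2.1
          exact absurd (h1 ▸ p.isSource) (not_isSource_head e)
        obtain ⟨h1, h2⟩ := isPath_concat.1 hp.2.1
        have h3 : p.edges = ρ ++ f :: p₂ := by simp [hp.1]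
        by_cases hfe : f = e
        · subst hfe
          refine Or.inr ⟨ρ, p₂, h3, ?_⟩
          simpa [hadd] using hr
        · refine Or.inl ⟨f, by simp [h3], ?_⟩
          refine (Φ.inLT_total h2 hv hfe).resolve_right fun h => ?_
          have := hα _ _ _ _ _ (isPath_concat.2 ⟨hπ, rfl⟩) hp.2.1
            ⟨[], π, ρ, e, f, rfl, rfl, h⟩
          have := hle hr
          omega
      · rintro (⟨f, hf, hfe⟩ | ⟨ρ, τ, hp, hr⟩)
        · obtain ⟨ρ, τ, hp⟩ := List.append_of_mem hf
          have hpp := p.isPath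
          rw [hp] at hpp
          obtain ⟨h1, h2⟩ := isPath_append_cons.1 hpp
          have h3 := isPath_concat.2 ⟨h1, hfe.head_eq⟩
          refine ⟨ρ ++ [f], τ, ⟨by simp [hp], h3, hfe.head_eq ▸ h2⟩, hlt ?_⟩
          exact hα _ _ _ _ _ h3 (isPath_concat.2 ⟨hπ, rfl⟩) ⟨[], ρ, π, f, e, rfl, rfl, hfe⟩
        · have hpp := p.isPath
          rw [hp] at hpp
          obtain ⟨h1, h2⟩ := isPath_append_cons.1 hpp
          exact ⟨ρ ++ [e], τ, ⟨by simp [hp], isPath_concat.2 ⟨h1, rfl⟩, h2⟩,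
            by simpa [hadd] using hr⟩
    · rw [Set.disjoint_left]
      rintro p ⟨f, hf, hfe⟩ ⟨ρ, τ, hp, hr⟩
      obtain rfl := p.isPath.eq_of_head_eq ht hf (show e ∈ p.edges by simp [hp]) hfe.head_eq
      exact Φ.inLT_irrefl _ hfe

end Coefficient

/-- The coefficients of a clique decomposition are determined by the flow. -/
theorem coefficient_eq [Finite V] [Fintype E] [Fintype G.Route] (hG : G.IsAcyclic)
    (hiso : ∀ v, G.IsSource v → ¬ G.IsSink v) {c : G.Route → ℝ} (h0 : ∀ p, 0 ≤ c p)
    (hclique : Φ.IsRouteClique {p | c p ≠ 0}) {F : E → ℝ}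
    (hc : ∀ e, ∑ p, c p * p.indicator e = F e) (p : G.Route) :
    c p = Φ.coefficient F p := by
  obtain ⟨t, ht⟩ := hG.exists_rank
  obtain ⟨α, hα⟩ := Φ.exists_preHeight ht
  obtain ⟨π, e, hp⟩ := (p.edges.eq_nil_or_concat').resolve_left (Route.edges_ne_nil hiso p)
  have hpp := p.isPath
  rw [hp] at hpp
  obtain ⟨hπ, he⟩ := isPath_concat.1 hpp
  have hsrc : ∀ {q : G.Route} {q₁ q₂}, q.SplitsAt p.start q₁ q₂ → q₁ = [] ∧ q.start = p.start := by
    intro q q₁ q₂ hq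
    have h1 := hq.2.1.eq_nil_of_isSource p.isSource
    refine ⟨h1, ?_⟩
    have h2 := hq.2.1
    rw [h1] at h2
    exact h2
  have hle : weight c (lowerRoutes G α (· ≤ ·) [] p.start) = ∑ e with G.tail e = p.start, F e := by
    rw [sum_flow_eq_weight hc fun p f hf g hg h h' =>
      p.isPath.eq_of_tail_eq ht hf hg (h.trans h'.symm)]
    congr 1
    ext q
    constructor
    · rintro ⟨q₁, q₂, hq, -⟩
      have hne := Route.edges_ne_nil hiso q
      have hqp := q.isPath
      cases hqe : q.edges with
      | nil => exact absurd hqe hne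
      | cons f l =>
        rw [hqe] at hqp
        exact ⟨f, by simp [hqe], hqp.1.trans (hsrc hq).2⟩
    · rintro ⟨f, hf, hfs⟩
      obtain ⟨ρ, τ, hq⟩ := List.append_of_mem hf
      have hqp := q.isPath
      rw [hq] at hqp
      obtain ⟨h1, h2⟩ := isPath_append_cons.1 hqp
      rw [hfs] at h1
      obtain rfl := h1.eq_nil_of_isSource p.isSource
      exact ⟨[], f :: τ, ⟨hq, h1, hfs, h2⟩, by simp⟩
  have hlt : weight c (lowerRoutes G α (· < ·) [] p.start) = 0 := by
    rw [← weight_empty (c := c)]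
    congr 1
    ext q
    refine iff_of_false ?_ (by simp)
    rintro ⟨q₁, q₂, hq, hr⟩
    simp at hr
  -- The recursion runs once with `≤` and once with `<`; the two sets of routes through the last
  -- edge `e` differ exactly by `p`. That edge is treated apart, because incoming edges are not
  -- ordered at its head, a sink. The offset in `transport` cancels in the difference.
  have e1 := weight_lowerRoutes ht hα h0 hclique hc (r := (· ≤ ·)) (fun h => h.le) (fun h => h)
    (by simp) hπ (not_isSink_tail e)
  have e2 := weight_lowerRoutes ht hα h0 hclique hc (r := (· < ·)) (fun h => h) (fun h => h.le)
    (by simp) hπ (not_isSink_tail e)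
  have f1 := weight_lowerRoutes_edge ht hα h0 hclique hc (r := (· ≤ ·)) (fun h => h.le)
    (fun h => h) π e
  have f2 := weight_lowerRoutes_edge ht hα h0 hclique hc (r := (· < ·)) (fun h => h)
    (fun h => h.le) π e
  rw [coefficient, hp, List.foldl_append, List.foldl_append, ← hlt, ← hle, ← e1, ← e2]
  simp only [List.foldl_cons, List.foldl_nil, transport]
  rw [← f1, ← f2, add_sub_add_left_eq_sub, eq_sub_iff_add_eq, ← weight_singleton (c := c) p,
    ← weight_union]
  · congr 1
    ext q
    constructor
    · rintro (rfl | ⟨ρ, τ, hq, hr⟩)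
      · exact ⟨π, [], hp, le_rfl⟩
      · exact ⟨ρ, τ, hq, hr.le⟩
    · rintro ⟨ρ, τ, hq, hr⟩
      rcases hr.lt_or_eq with hr | hr
      · exact Or.inr ⟨ρ, τ, hq, hr⟩
      left
      have hqp := q.isPath
      rw [hq] at hqp
      obtain ⟨h1, h2⟩ := isPath_append_cons.1 hqp
      have hτ := h2.eq_nil_of_isSink (he ▸ p.isSink)
      -- Distinct paths from sources to this vertex are comparable and hence have different heights.
      have hρ : ρ = π := by
        by_contra hne
        rcases Φ.preLT_total h1 hπ q.isSource p.isSource (not_isSink_tail e) hne with h | h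
        · exact absurd hr (hα _ _ _ _ _ h1 hπ h).ne
        · exact absurd hr (hα _ _ _ _ _ hπ h1 h).ne'
      refine Route.ext_edges (Route.edges_ne_nil hiso q) ?_
      rw [hq, hp, hτ, hρ]
  · rw [Set.disjoint_left]
    rintro q rfl ⟨ρ, τ, hq, hr⟩
    have hqp := q.isPath
    rw [hq] at hqp
    obtain ⟨h1, h2⟩ := isPath_append_cons.1 hqp
    obtain rfl := h2.eq_nil_of_isSink (he ▸ q.isSink)
    have : ρ = π := (List.append_inj' (hq.symm.trans hp) rfl).1
    rw [this] at hr
    exact lt_irrefl _ hr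

theorem IsRouteClique.mono {R S : Set G.Route} (hS : Φ.IsRouteClique S) (h : R ⊆ S) :
    Φ.IsRouteClique R :=
  fun p hp q hq => hS p (h hp) q (h hq)

/-- A signed combination of the routes of a clique is determined by any nonnegative shift. -/
theorem IsRouteClique.coeff_eq [Finite V] [Fintype E] [Fintype G.Route] (hG : G.IsAcyclic)
    (hiso : ∀ v, G.IsSource v → ¬ G.IsSink v) {R : Set G.Route} (hR : Φ.IsRouteClique R)
    {c : G.Route → ℝ} (hc : ∀ p, c p ≠ 0 → p ∈ R) :
    ∃ n : G.Route → ℕ, ∀ p,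
      c p = Φ.coefficient (fun e => ∑ p, (c p + n p) * p.indicator e) p - n p ∧
      (n p : ℝ) = Φ.coefficient (fun e => ∑ p, (n p : ℝ) * p.indicator e) p := by
  -- The shift by natural numbers makes `c + n` and `n` two nonnegative weights on the same clique,
  -- to which `coefficient_eq` applies.
  refine ⟨fun p => ⌈|c p|⌉₊, fun p => ⟨eq_sub_iff_add_eq.2 ?_, ?_⟩⟩
  · refine coefficient_eq (Φ := Φ) hG hiso (c := fun p => c p + (⌈|c p|⌉₊ : ℝ)) ?_ ?_
      (fun e => rfl) p
    · intro p
      have := Nat.le_ceil |c p|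
      have := neg_abs_le (c p)
      change 0 ≤ c p + (⌈|c p|⌉₊ : ℝ)
      linarith
    · refine hR.mono fun p hp => hc p fun h => hp ?_
      simp [h]
  · refine coefficient_eq (Φ := Φ) hG hiso (c := fun p => (⌈|c p|⌉₊ : ℝ))
      (fun p => Nat.cast_nonneg _) ?_ (fun e => rfl) p
    refine hR.mono fun p hp => hc p fun h => hp ?_
    simp [h]

/-- The routes of a clique are linearly independent. -/
theorem IsRouteClique.eq_zero [Finite V] [Fintype E] [Fintype G.Route] (hG : G.IsAcyclic)
    (hiso : ∀ v, G.IsSource v → ¬ G.IsSink v) {R : Set G.Route} (hR : Φ.IsRouteClique R)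
    {c : G.Route → ℝ} (hc : ∀ p, c p ≠ 0 → p ∈ R)
    (h : ∀ e, ∑ p, c p * p.indicator e = 0) (p : G.Route) : c p = 0 := by
  obtain ⟨n, hn⟩ := hR.coeff_eq hG hiso hc
  rw [(hn p).1, sub_eq_zero, (hn p).2]
  simp only [add_mul, Finset.sum_add_distrib, h, zero_add, ← (hn p).2]

/-- If a linear combination of the routes of a clique is an integer point, then its coefficients
are integers. -/
theorem IsRouteClique.isInteger [Finite V] [Fintype E] [Fintype G.Route] (hG : G.IsAcyclic)
    (hiso : ∀ v, G.IsSource v → ¬ G.IsSink v) {R : Set G.Route} (hR : Φ.IsRouteClique R)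
    {c : G.Route → ℝ} (hc : ∀ p, c p ≠ 0 → p ∈ R)
    (h : ∀ e, ∑ p, c p * p.indicator e ∈ (Int.castAddHom ℝ).range) (p : G.Route) :
    c p ∈ (Int.castAddHom ℝ).range := by
  obtain ⟨n, hn⟩ := hR.coeff_eq hG hiso hc
  rw [(hn p).1]
  refine sub_mem (coefficient_mem Φ (fun e => ?_) p) ⟨n p, by simp⟩
  simp only [add_mul, Finset.sum_add_distrib]
  refine add_mem (h e) (sum_mem fun p _ => ?_)
  by_cases he : e ∈ p.edges
  · rw [Route.indicator_of_mem he]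
    exact ⟨n p, by simp⟩
  · rw [Route.indicator_of_notMem he]
    exact ⟨0, by simp⟩

end Framing
end DirectedMultigraph

namespace DirectedMultigraph

variable {V E : Type*} {G : DirectedMultigraph V E} {a : V → ℤ}

/-! ### Layerings -/

namespace IsConservationist

theorem not_isSink (ha : G.IsConservationist a) (v : V) (hv : G.IsSource v) : ¬ G.IsSink v := by
  intro h
  have h1 := ha.source v hv
  have h2 := ha.sink v h
  omega

end IsConservationist

namespace Layering

variable (L M : G.Layering a)

theorem routeFrom_mem (s : {v : V // G.IsSource v}) : L.routeFrom s ∈ L.routes :=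
  (L.existsUnique_start s s.2).choose_spec.1.1

theorem routeFrom_start (s : {v : V // G.IsSource v}) : (L.routeFrom s).start = s :=
  (L.existsUnique_start s s.2).choose_spec.1.2

theorem eq_routeFrom {p : G.Route} (hp : p ∈ L.routes) {s : {v : V // G.IsSource v}}
    (hs : p.start = s) : p = L.routeFrom s :=
  (L.existsUnique_start s s.2).choose_spec.2 p ⟨hp, hs⟩

variable {L M}

theorem ext_routeFrom (h : ∀ s, L.routeFrom s = M.routeFrom s) : L = M := by
  have key : ∀ {L M : G.Layering a}, (∀ s, L.routeFrom s = M.routeFrom s) →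
      ∀ p ∈ L.routes, p ∈ M.routes := by
    intro L M h p hp
    rw [L.eq_routeFrom hp (s := ⟨p.start, p.isSource⟩) rfl, h]
    exact M.routeFrom_mem _
  refine Layering.ext (Finset.ext fun p => ⟨key h p, key (fun s => (h s).symm) p⟩)

theorem finite (hR : Finite G.Route) : Finite (G.Layering a) :=
  Finite.of_injective (fun L : G.Layering a => L.routes) fun _ _ h => Layering.ext h

theorem sum_start [Fintype G.Route] (L : G.Layering a) {s : V} (hs : G.IsSource s) :
    ∑ p with p.start = s, (if p ∈ L.routes then (1 : ℝ) else 0) = 1 := by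
  rw [← Finset.sum_filter, Finset.filter_filter, Finset.sum_const, nsmul_one]
  obtain ⟨p, hp, huniq⟩ := L.existsUnique_start s hs
  have : (Finset.univ.filter fun p : G.Route => p.start = s ∧ p ∈ L.routes) = {p} := by
    ext q
    simp only [Finset.mem_filter, Finset.mem_univ, true_and, Finset.mem_singleton]
    constructor
    · exact fun h => huniq q ⟨h.2, h.1⟩
    · rintro rfl
      exact ⟨hp.2, hp.1⟩
  rw [this]
  simp

theorem sum_finish [Fintype G.Route] (L : G.Layering a) {j : V} (hj : G.IsSink j) :
    ∑ p with p.finish = j, (if p ∈ L.routes then (1 : ℝ) else 0) = |a j| := by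
  rw [← Finset.sum_filter, Finset.filter_filter, Finset.sum_const, nsmul_one]
  have h := L.card_finish j hj
  have : {p ∈ (L.routes : Set G.Route) | p.finish = j} =
      ((Finset.univ.filter fun p : G.Route => p.finish = j ∧ p ∈ L.routes : Finset G.Route) :
        Set G.Route) := by
    ext q
    simp [and_comm]
  rw [this, Set.ncard_coe_finset] at h
  exact_mod_cast h

end Layering

/-! ### The order on layerings, and uniqueness of layering coefficients -/

namespace Framing

variable {Φ : G.Framing}

theorem postLT_irrefl (l : List E) : ¬ Φ.PostLT l l := by
  rintro ⟨σ, p, q, f, g, h1, h2, h⟩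
  have := List.append_cancel_left (h1.symm.trans h2)
  rw [(List.cons.inj this).1] at h
  exact Φ.outLT_irrefl _ h

theorem postLT_trans [Finite V] [Fintype E] (hG : G.IsAcyclic) {p q r : G.Route}
    (hpq : p.start = q.start) (hqr : q.start = r.start) (h : Φ.PostLT p.edges q.edges)
    (h' : Φ.PostLT q.edges r.edges) : Φ.PostLT p.edges r.edges := by
  obtain ⟨t, ht⟩ := hG.exists_corank
  obtain ⟨β, hβ⟩ := Φ.exists_postHeight ht
  have hp := p.isPath
  rw [hpq, hqr] at hp
  have hq := q.isPath
  rw [hqr] at hq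
  have h1 := hβ _ _ _ _ _ hp hq h
  have h2 := hβ _ _ _ _ _ hq r.isPath h'
  refine (Φ.postLT_total hp r.isPath p.isSink r.isSink fun h => ?_).resolve_right fun h => ?_
  · rw [h] at h1
    exact lt_asymm h1 h2
  · have := hβ _ _ _ _ _ r.isPath hp h
    omega

/-- The post-source order is a total order on layerings. -/
theorem exists_linearOrder [Finite V] [Fintype E] (hG : G.IsAcyclic) (Φ : G.Framing)
    (a : V → ℤ) : ∃ o : LinearOrder (G.Layering a), ∀ L M, o.lt L M ↔ Φ.LayeringLT L M := by
  let := Φ.srcOrder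
  have : IsStrictTotalOrder (G.Layering a) Φ.LayeringLT :=
    { irrefl := by
        rintro L ⟨s, h, -⟩
        exact postLT_irrefl _ h
      trans := by
        rintro L M N ⟨s, h, hs⟩ ⟨s', h', hs'⟩
        rcases lt_trichotomy s s' with hlt | rfl | hlt
        · exact ⟨s', hs s' hlt ▸ h', fun t ht => (hs t (hlt.trans ht)).trans (hs' t ht)⟩
        · refine ⟨s, ?_, fun t ht => (hs t ht).trans (hs' t ht)⟩
          refine postLT_trans hG ?_ ?_ h h' <;> simp only [Layering.routeFrom_start]
        · exact ⟨s, hs' s hlt ▸ h, fun t ht => (hs t ht).trans (hs' t (hlt.trans ht))⟩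
      trichotomous := by
        intro L M h1 h2
        by_contra hne
        obtain ⟨s, hs, hmax⟩ := (Set.toFinite {s | L.routeFrom s ≠ M.routeFrom s}).exists_maximal
          (by
            by_contra hemp
            refine hne (Layering.ext_routeFrom fun s => ?_)
            by_contra hs
            exact hemp ⟨s, hs⟩)
        have heq : ∀ t, s < t → L.routeFrom t = M.routeFrom t := by
          intro t ht
          by_contra hc
          exact not_le_of_gt ht (hmax hc ht.le)
        have hL := (L.routeFrom s).isPath
        have hM := (M.routeFrom s).isPath
        rw [L.routeFrom_start] at hL
        rw [M.routeFrom_start] at hM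
        have hne' : (L.routeFrom s).edges ≠ (M.routeFrom s).edges := by
          intro he
          by_cases hnil : (L.routeFrom s).edges = []
          · rw [← he] at hM
            rw [hnil] at hL hM
            refine hs (Route.ext ?_ he ?_)
            · rw [L.routeFrom_start, M.routeFrom_start]
            · exact (show _ = _ from hL).symm.trans hM
          · exact hs (Route.ext_edges hnil he)
        rcases Φ.postLT_total hL hM (L.routeFrom s).isSink (M.routeFrom s).isSink hne' with h | h
        · exact h1 ⟨s, h, heq⟩
        · exact h2 ⟨s, h, fun t ht => (heq t ht).symm⟩ }
  exact ⟨linearOrderOfSTO Φ.LayeringLT, fun L M => Iff.rfl⟩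

/-- The weight of a route in a combination of layerings. -/
def routeWeight (K : Finset (G.Layering a)) (y : G.Layering a → ℝ) (p : G.Route) : ℝ :=
  ∑ L ∈ K, if p ∈ L.routes then y L else 0

theorem sum_indicator [Fintype G.Route] (K : Finset (G.Layering a)) (y : G.Layering a → ℝ)
    (e : E) : ∑ L ∈ K, y L * L.indicator e = ∑ p, routeWeight K y p * p.indicator e := by
  simp only [routeWeight, Finset.sum_mul]
  rw [Finset.sum_comm]
  refine Finset.sum_congr rfl fun L _ => ?_
  simp [Layering.indicator, Finset.mul_sum, ite_mul]

theorem routeWeight_nonneg {K : Finset (G.Layering a)} {y : G.Layering a → ℝ}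
    (hy : ∀ L ∈ K, 0 ≤ y L) (p : G.Route) : 0 ≤ routeWeight K y p := by
  refine Finset.sum_nonneg fun L hL => ?_
  split_ifs
  · exact hy L hL
  · exact le_rfl

theorem routeWeight_mem {K : Finset (G.Layering a)} {y : G.Layering a → ℝ} {p : G.Route}
    (h : routeWeight K y p ≠ 0) : p ∈ routesOf (K : Set (G.Layering a)) := by
  obtain ⟨L, hL, hne⟩ := Finset.exists_ne_zero_of_sum_ne_zero h
  exact ⟨L, hL, by by_contra hp; simp [hp] at hne⟩

theorem le_routeWeight {K : Finset (G.Layering a)} {y : G.Layering a → ℝ}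
    (hy : ∀ L ∈ K, 0 ≤ y L) {L : G.Layering a} (hL : L ∈ K) {p : G.Route} (hp : p ∈ L.routes) :
    y L ≤ routeWeight K y p := by
  have := Finset.single_le_sum (f := fun L : G.Layering a => if p ∈ L.routes then y L else 0)
    (fun L hL => by
      change 0 ≤ if p ∈ L.routes then y L else 0
      split_ifs
      · exact hy L hL
      · exact le_rfl) hL
  simp only [if_pos hp] at this
  exact this

/-- Passing to a subset leaves fewer routes, hence fewer competitors for the minimum and fewer
larger members that could contain a new route. This gives the faces of the simplices. -/
theorem IsLayeringSimplex.mono {K K' : Finset (G.Layering a)} (hK : Φ.IsLayeringSimplex K)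
    (h : K' ⊆ K) : Φ.IsLayeringSimplex K' := by
  refine ⟨hK.clique.mono ?_, fun L hL M hM => hK.minimal L (h hL) M fun p hp => ?_,
    fun L hL => ?_⟩
  · rintro p ⟨L, hL, hp⟩
    exact ⟨L, h hL, hp⟩
  · obtain ⟨N, ⟨hN, hLN⟩, hpN⟩ := hM p hp
    exact ⟨N, ⟨h hN, hLN⟩, hpN⟩
  · obtain ⟨p, hp, hnew⟩ := hK.new_route L (h hL)
    exact ⟨p, hp, fun ⟨N, ⟨hN, hLN⟩, hpN⟩ => hnew ⟨N, ⟨h hN, hLN⟩, hpN⟩⟩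

section Order

variable [o : LinearOrder (G.Layering a)] (ho : ∀ L M : G.Layering a, L < M ↔ Φ.LayeringLT L M)

include ho

theorem isLayeringSimplex_iff {K : Finset (G.Layering a)} :
    Φ.IsLayeringSimplex K ↔ Φ.IsRouteClique (routesOf (K : Set (G.Layering a))) ∧
      (∀ L ∈ K, ∀ M : G.Layering a, (∀ p ∈ M.routes, ∃ N ∈ K, L ≤ N ∧ p ∈ N.routes) → L ≤ M) ∧
      ∀ L ∈ K, ∃ p ∈ L.routes, ∀ N ∈ K, L < N → p ∉ N.routes := by
  have hle : ∀ L M : G.Layering a, (L = M ∨ Φ.LayeringLT L M) ↔ L ≤ M := by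
    intro L M
    rw [← ho, le_iff_eq_or_lt]
  constructor
  · rintro ⟨h1, h2, h3⟩
    refine ⟨h1, fun L hL M hM => (hle _ _).1 (h2 L hL M fun p hp => ?_), fun L hL => ?_⟩
    · obtain ⟨N, hN, hLN, hpN⟩ := hM p hp
      exact ⟨N, ⟨hN, (hle _ _).2 hLN⟩, hpN⟩
    · obtain ⟨p, hp, hnew⟩ := h3 L hL
      exact ⟨p, hp, fun N hN hLN hpN => hnew ⟨N, ⟨hN, (ho _ _).1 hLN⟩, hpN⟩⟩
  · rintro ⟨h1, h2, h3⟩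
    refine ⟨h1, fun L hL M hM => (hle _ _).2 (h2 L hL M fun p hp => ?_), fun L hL => ?_⟩
    · obtain ⟨N, ⟨hN, hLN⟩, hpN⟩ := hM p hp
      exact ⟨N, hN, (hle _ _).1 hLN, hpN⟩
    · obtain ⟨p, hp, hnew⟩ := h3 L hL
      exact ⟨p, hp, fun ⟨N, ⟨hN, hLN⟩, hpN⟩ => hnew N hN ((ho _ _).2 hLN) hpN⟩

/-- The coefficients of the layerings lie in every group that contains the weights of the routes. -/
theorem IsLayeringSimplex.coeff_mem [Finite (G.Layering a)] {K : Finset (G.Layering a)}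
    (hK : Φ.IsLayeringSimplex K) {y : G.Layering a → ℝ} {H : AddSubgroup ℝ}
    (hH : ∀ p, routeWeight K y p ∈ H) : ∀ L ∈ K, y L ∈ H := by
  intro L
  induction L using WellFoundedLT.induction with
  | ind L ih =>
  intro hL
  -- The weight of the new route `p` of `L` is `y L` plus coefficients of smaller layerings: the
  -- system is unitriangular.
  obtain ⟨p, hp, hnew⟩ := ((isLayeringSimplex_iff ho).1 hK).2.2 L hL
  have h1 := hH p
  rw [routeWeight, ← Finset.add_sum_erase _ _ hL, if_pos hp] at h1
  refine (H.add_mem_cancel_right (H.sum_mem fun N hN => ?_)).1 h1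
  obtain ⟨hne, hN⟩ := Finset.mem_erase.1 hN
  split_ifs with hpN
  · exact ih N (lt_of_le_of_ne (not_lt.1 fun h => hnew N hN h hpN) hne) hN
  · exact H.zero_mem

/-- The route weights determine the least layering and its coefficient; removing it from both sides
leaves a smaller instance. -/
theorem IsLayeringSimplex.unique (n : ℕ) {K K' : Finset (G.Layering a)}
    (hK : Φ.IsLayeringSimplex K) (hK' : Φ.IsLayeringSimplex K') {d d' : G.Layering a → ℝ}
    (hd : ∀ L ∈ K, 0 < d L) (hd' : ∀ L ∈ K', 0 < d' L)
    (h : ∀ p, routeWeight K d p = routeWeight K' d' p) (hn : K.card ≤ n) : K = K' := by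
  induction n generalizing K K' with
  | zero =>
    obtain rfl : K = ∅ := Finset.card_eq_zero.1 (by omega)
    by_contra hne
    obtain ⟨L, hL⟩ := Finset.nonempty_iff_ne_empty.2 fun h => hne h.symm
    obtain ⟨p, hp, -⟩ := hK'.new_route L hL
    have h1 := le_routeWeight (fun L hL => (hd' L hL).le) hL hp
    rw [← h p] at h1
    have h2 := hd' L hL
    simp only [routeWeight, Finset.sum_empty] at h1
    linarith
  | succ n ih =>
    have hne : ∀ {K K' : Finset (G.Layering a)} {d d' : G.Layering a → ℝ},
        Φ.IsLayeringSimplex K → (∀ L ∈ K, 0 < d L) →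
        (∀ p, routeWeight K d p = routeWeight K' d' p) → K.Nonempty → K'.Nonempty := by
      rintro K K' d d' hK hd h ⟨L, hL⟩
      obtain ⟨p, hp, -⟩ := hK.new_route L hL
      have h1 := le_routeWeight (fun L hL => (hd L hL).le) hL hp
      rw [h p] at h1
      rw [Finset.nonempty_iff_ne_empty]
      rintro rfl
      have h2 := hd L hL
      simp only [routeWeight, Finset.sum_empty] at h1
      linarith
    rcases K.eq_empty_or_nonempty with rfl | hKne
    · by_contra hcon
      exact Finset.not_nonempty_empty (hne hK' hd' (fun p => (h p).symm)
        (Finset.nonempty_iff_ne_empty.2 fun h => hcon h.symm))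
    have hKne' := hne hK hd h hKne
    -- The least member of `K'` uses only routes of positive weight, which are routes of `K`, so it
    -- competes in the minimality condition of `K`.
    have hmin : ∀ {K K' : Finset (G.Layering a)} {d d' : G.Layering a → ℝ}
        (hne : K.Nonempty) (hne' : K'.Nonempty), Φ.IsLayeringSimplex K →
        (∀ L ∈ K', 0 < d' L) →
        (∀ p, routeWeight K d p = routeWeight K' d' p) → K.min' hne ≤ K'.min' hne' := by
      intro K K' d d' hne hne' hK hd' h
      refine ((isLayeringSimplex_iff ho).1 hK).2.1 _ (K.min'_mem hne) _ fun p hp => ?_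
      have h1 := le_routeWeight (fun L hL => (hd' L hL).le) (K'.min'_mem hne') hp
      rw [← h p] at h1
      have h2 := hd' _ (K'.min'_mem hne')
      obtain ⟨N, hN, hpN⟩ := routeWeight_mem (K := K) (y := d) (p := p) (by linarith)
      exact ⟨N, hN, K.min'_le N hN, hpN⟩
    have heq : K.min' hKne = K'.min' hKne' :=
      le_antisymm (hmin _ _ hK hd' h) (hmin _ _ hK' hd fun p => (h p).symm)
    -- The new route of the least member of `K` lies in no other member, so its weight is exactly
    -- the coefficient there, while in `K'` it is at least the coefficient.
    have hle : ∀ {K K' : Finset (G.Layering a)} {d d' : G.Layering a → ℝ}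
        (hne : K.Nonempty) (hne' : K'.Nonempty), Φ.IsLayeringSimplex K →
        (∀ L ∈ K', 0 < d' L) →
        (∀ p, routeWeight K d p = routeWeight K' d' p) → K.min' hne = K'.min' hne' →
        d' (K.min' hne) ≤ d (K.min' hne) := by
      intro K K' d d' hne hne' hK hd' h heq
      obtain ⟨p, hp, hnew⟩ := ((isLayeringSimplex_iff ho).1 hK).2.2 _ (K.min'_mem hne)
      have h1 := le_routeWeight (fun L hL => (hd' L hL).le) (K'.min'_mem hne') (heq ▸ hp)
      rw [← h p, routeWeight, Finset.sum_eq_single (K.min' hne), if_pos hp, ← heq] at h1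
      · exact h1
      · intro N hN hNne
        rw [if_neg (hnew N hN (lt_of_le_of_ne (K.min'_le N hN) hNne.symm))]
      · exact fun h => absurd (K.min'_mem hne) h
    have hdeq : d (K.min' hKne) = d' (K.min' hKne) := by
      refine le_antisymm ?_ (hle _ _ hK hd' h heq)
      have := hle _ _ hK' hd (fun p => (h p).symm) heq.symm
      rwa [← heq] at this
    have hL := K.min'_mem hKne
    have hL' := K'.min'_mem hKne'
    rw [← heq] at hL'
    have := ih (K := K.erase (K.min' hKne)) (K' := K'.erase (K.min' hKne))
      (hK.mono (Finset.erase_subset _ _)) (hK'.mono (Finset.erase_subset _ _))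
      (fun L hL => hd L (Finset.mem_of_mem_erase hL))
      (fun L hL => hd' L (Finset.mem_of_mem_erase hL)) ?_ ?_
    · rw [← Finset.insert_erase hL, this, Finset.insert_erase hL']
    · intro p
      have := h p
      simp only [routeWeight] at this ⊢
      rw [← Finset.add_sum_erase _ _ hL, ← Finset.add_sum_erase _ _ hL', hdeq] at this
      linarith
    · rw [Finset.card_erase_of_mem hL]
      omega

end Order

end Framing

/-- By Hall's theorem, the support of a balanced weight on routes contains a layering. -/
theorem exists_layering [Fintype V] [Fintype G.Route] {c : G.Route → ℝ} (h0 : ∀ p, 0 ≤ c p)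
    {x : ℝ} (hx : 0 < x) (hs : ∀ s, G.IsSource s → ∑ p with p.start = s, c p = x)
    (hj : ∀ j, G.IsSink j → ∑ p with p.finish = j, c p = x * |a j|) :
    ∃ L : G.Layering a, ∀ p ∈ L.routes, c p ≠ 0 := by
  let S := {v : V // G.IsSource v}
  let J := {v : V // G.IsSink v}
  -- Each sink is split into `|a j|` places, so that a layering becomes a perfect matching of
  -- sources with places.
  let slot := Σ j : J, Fin (a j).natAbs
  have hS : ∀ A : Finset S, x * A.card =
      ∑ p : G.Route with ∃ s : S, s ∈ A ∧ p.start = s.1, c p := by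
    intro A
    have : (Finset.univ.filter fun p : G.Route => ∃ s : S, s ∈ A ∧ p.start = s) =
        A.biUnion fun s => Finset.univ.filter fun p : G.Route => p.start = s := by
      ext p
      simp
    rw [this, Finset.sum_biUnion]
    · rw [Finset.sum_congr rfl fun (s : S) _ => hs s.1 s.2, Finset.sum_const,
        nsmul_eq_mul, mul_comm]
    · intro s _ s' _ hne
      refine Finset.disjoint_left.2 fun p hp hp' => hne ?_
      simp only [Finset.mem_filter, Finset.mem_univ, true_and] at hp hp'
      exact Subtype.ext (hp.symm.trans hp')
  have hJ : ∀ B : Finset J, x * (∑ j ∈ B, (a j).natAbs : ℕ) =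
      ∑ p : G.Route with ∃ j : J, j ∈ B ∧ p.finish = j.1, c p := by
    intro B
    have : (Finset.univ.filter fun p : G.Route => ∃ j : J, j ∈ B ∧ p.finish = j) =
        B.biUnion fun j => Finset.univ.filter fun p : G.Route => p.finish = j := by
      ext p
      simp
    rw [this, Finset.sum_biUnion]
    · rw [Finset.sum_congr rfl fun (j : J) _ => hj j.1 j.2, Nat.cast_sum, Finset.mul_sum]
      refine Finset.sum_congr rfl fun j _ => ?_
      rw [Nat.cast_natAbs]
    · intro s _ s' _ hne
      refine Finset.disjoint_left.2 fun p hp hp' => hne ?_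
      simp only [Finset.mem_filter, Finset.mem_univ, true_and] at hp hp'
      exact Subtype.ext (hp.symm.trans hp')
  let T : S → Finset slot := fun s =>
    Finset.univ.filter fun k => ∃ p : G.Route, c p ≠ 0 ∧ p.start = s ∧ p.finish = k.1
  have hall : ∀ A : Finset S, A.card ≤ (A.biUnion T).card := by
    intro A
    let B : Finset J := Finset.univ.filter fun j =>
      ∃ s ∈ A, ∃ p : G.Route, c p ≠ 0 ∧ p.start = s ∧ p.finish = j
    have h1 : A.biUnion T = B.sigma fun _ => Finset.univ := by
      ext k
      rw [Finset.mem_biUnion, Finset.mem_sigma]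
      simp [T, B]
    rw [h1, Finset.card_sigma]
    simp only [Finset.card_univ, Fintype.card_fin]
    -- Hall's condition: all the weight starting in `A` ends at sinks in `B`, whose total weight is
    -- the right-hand side.
    have h2 : x * A.card ≤ x * (∑ j ∈ B, (a j).natAbs : ℕ) := by
      rw [hS, hJ]
      rw [← Finset.sum_filter_ne_zero]
      refine Finset.sum_le_sum_of_subset_of_nonneg (fun p hp => ?_) fun p _ _ => h0 p
      simp only [Finset.mem_filter, Finset.mem_univ, true_and] at hp ⊢
      obtain ⟨⟨s, hs, hps⟩, hc⟩ := hp
      exact ⟨⟨p.finish, p.isSink⟩, by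
        simp only [B, Finset.mem_filter, Finset.mem_univ, true_and]
        exact ⟨s, hs, p, hc, hps, rfl⟩, rfl⟩
    exact_mod_cast le_of_mul_le_mul_left h2 hx
  obtain ⟨f, hf, hfT⟩ := (Finset.all_card_le_biUnion_card_iff_exists_injective T).1 hall
  -- Multiplied by `x`, both numbers are the total weight of all routes.
  have hcard : Fintype.card S = Fintype.card slot := by
    have h3 := Finset.sum_congr (f := c) (Finset.filter_true_of_mem
      (p := fun p : G.Route => ∃ s : S, s ∈ Finset.univ ∧ p.start = s.1) (s := Finset.univ)
      fun p _ => ⟨⟨_, p.isSource⟩, Finset.mem_univ _, rfl⟩) fun _ _ => rfl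
    have h3' := Finset.sum_congr (f := c) (Finset.filter_true_of_mem
      (p := fun p : G.Route => ∃ j : J, j ∈ Finset.univ ∧ p.finish = j.1) (s := Finset.univ)
      fun p _ => ⟨⟨_, p.isSink⟩, Finset.mem_univ _, rfl⟩) fun _ _ => rfl
    have h1 : x * (Finset.univ : Finset S).card = ∑ p, c p := by
      rw [hS, ← h3]
      congr!
    have h2 : x * (∑ j : J, (a j).natAbs : ℕ) = ∑ p, c p := by
      rw [hJ, ← h3']
      congr!
    rw [← h2] at h1
    have h4 := mul_left_cancel₀ hx.ne' h1
    rw [Fintype.card_sigma]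
    simp only [Fintype.card_fin]
    rw [← Finset.card_univ]
    exact_mod_cast h4
  have hbij : Function.Bijective f := (Fintype.bijective_iff_injective_and_card f).2 ⟨hf, hcard⟩
  choose p hpc hps hpf using fun s => (Finset.mem_filter.1 (hfT s)).2
  have hpinj : Function.Injective p := fun s s' h => Subtype.ext (by rw [← hps, h, hps])
  refine ⟨⟨Finset.univ.image p, fun s hs => ⟨p ⟨s, hs⟩, ⟨by simp, hps _⟩, ?_⟩, fun j hj => ?_⟩, ?_⟩
  · rintro q ⟨hq, hqs⟩
    obtain ⟨s', -, rfl⟩ := Finset.mem_image.1 hq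
    congr 1
    exact Subtype.ext ((hps s').symm.trans hqs)
  · let g := Equiv.ofBijective f hbij
    have : {q ∈ ((Finset.univ.image p : Finset G.Route) : Set G.Route) | q.finish = j} =
        Set.range fun k : Fin (a j).natAbs => p (g.symm ⟨⟨j, hj⟩, k⟩) := by
      ext q
      simp only [Finset.coe_image, Finset.coe_univ, Set.image_univ, Set.mem_range,
        Set.mem_ofPred_eq]
      constructor
      · rintro ⟨⟨s, rfl⟩, hq⟩
        have h1 : (f s).1 = ⟨j, hj⟩ := Subtype.ext ((hpf s).symm.trans hq)
        obtain ⟨k, hk⟩ : ∃ k : Fin (a j).natAbs, f s = ⟨⟨j, hj⟩, k⟩ := by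
          rcases hfs : f s with ⟨j', k⟩
          rw [hfs] at h1
          subst h1
          exact ⟨k, rfl⟩
        refine ⟨k, ?_⟩
        rw [← hk]
        congr 1
        exact g.symm_apply_apply s
      · rintro ⟨k, rfl⟩
        refine ⟨⟨_, rfl⟩, ?_⟩
        rw [hpf]
        have : f (g.symm ⟨⟨j, hj⟩, k⟩) = ⟨⟨j, hj⟩, k⟩ := g.apply_symm_apply _
        rw [this]
    have hinj : Function.Injective fun k : Fin (a j).natAbs => p (g.symm ⟨⟨j, hj⟩, k⟩) :=
      fun k k' h => eq_of_heq (Sigma.mk.inj (g.symm.injective (hpinj h))).2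
    rw [this, ← Set.image_univ, Set.ncard_image_of_injective _ hinj, Set.ncard_univ, Nat.card_fin]
    simp
  · intro q hq
    obtain ⟨s, -, rfl⟩ := Finset.mem_image.1 hq
    exact hpc s

/-! ### Peeling layerings off a balanced weight -/

namespace Framing

variable {Φ : G.Framing}

/-- Every balanced weight on the routes of a clique is a positive combination of the layerings of a
layering-simplex. -/
theorem exists_layeringSimplex [Fintype V] [Fintype G.Route]
    (hsrc : ∃ s, G.IsSource s) [o : LinearOrder (G.Layering a)]
    (ho : ∀ L M : G.Layering a, L < M ↔ Φ.LayeringLT L M) (n : ℕ) {c : G.Route → ℝ}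
    (h0 : ∀ p, 0 ≤ c p) (hclique : Φ.IsRouteClique {p | c p ≠ 0}) {x : ℝ}
    (hs : ∀ s, G.IsSource s → ∑ p with p.start = s, c p = x)
    (hj : ∀ j, G.IsSink j → ∑ p with p.finish = j, c p = x * |a j|)
    (hn : (Finset.univ.filter fun p => c p ≠ 0).card ≤ n) :
    ∃ (K : Finset (G.Layering a)) (d : G.Layering a → ℝ), Φ.IsLayeringSimplex K ∧
      (∀ L ∈ K, 0 < d L) ∧ ∀ p, routeWeight K d p = c p := by
  induction n generalizing c x with
  | zero =>
    refine ⟨∅, 0, ⟨?_, by simp, by simp⟩, by simp, fun p => ?_⟩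
    · rintro p ⟨L, hL, -⟩
      simp at hL
    · have := Finset.card_eq_zero.1 (Nat.le_zero.1 hn)
      by_contra hp
      have h1 : p ∈ (∅ : Finset G.Route) := by
        rw [← this]
        simp only [Finset.mem_filter, Finset.mem_univ, true_and]
        intro h
        exact hp (by simp [routeWeight, h])
      simp at h1
  | succ n ih =>
    by_cases hc0 : ∀ p, c p = 0
    · exact ih h0 hclique hs hj (by simp [hc0])
    push Not at hc0
    obtain ⟨p, hp⟩ := hc0
    have hx : 0 < x := by
      rw [← hs _ p.isSource]
      exact Finset.sum_pos' (fun q _ => h0 q) ⟨p, by simp, (h0 p).lt_of_ne' hp⟩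
    have : Finite (G.Layering a) := Layering.finite inferInstance
    obtain ⟨L, hL, hmin⟩ := (Set.toFinite
      {L : G.Layering a | ∀ p ∈ L.routes, c p ≠ 0}).exists_minimal
      (exists_layering h0 hx hs hj)
    replace hmin : ∀ M : G.Layering a, (∀ p ∈ M.routes, c p ≠ 0) → L ≤ M := fun M hM =>
      (le_total L M).elim id fun h => hmin hM h
    obtain ⟨s, hsrc'⟩ := hsrc
    -- Subtracting `c q` times the layering `L` removes `q` from the support and keeps the weight
    -- nonnegative.
    obtain ⟨q, hq, hqmin⟩ := L.routes.exists_min_image c ⟨_, L.routeFrom_mem ⟨s, hsrc'⟩⟩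
    have hcq : 0 < c q := (h0 q).lt_of_ne' (hL q hq)
    let c' : G.Route → ℝ := fun p => c p - c q * if p ∈ L.routes then 1 else 0
    have hc'0 : ∀ p, 0 ≤ c' p := by
      intro p
      simp only [c']
      split_ifs with hpL
      · linarith [hqmin p hpL]
      · simpa using h0 p
    have hsupp : ∀ p, c' p ≠ 0 → c p ≠ 0 := by
      intro p hp' hp
      refine hp' (le_antisymm ?_ (hc'0 p))
      simp only [c', hp]
      split_ifs <;> linarith
    have hq' : c' q = 0 := by simp [c', hq]
    have key := ih (c := c') (x := x - c q) hc'0 (hclique.mono hsupp) ?_ ?_ ?_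
    · obtain ⟨K, d, hK, hd, hKc⟩ := key
      have hKs : ∀ N ∈ K, ∀ p ∈ N.routes, c' p ≠ 0 := by
        intro N hN p hpN
        have := le_routeWeight (fun L hL => (hd L hL).le) hN hpN
        rw [hKc] at this
        exact (lt_of_lt_of_le (hd N hN) this).ne'
      -- The layerings still to come live on the smaller support, so they are at least `L`, and they
      -- differ from `L` because they avoid `q`.
      have hlt : ∀ N ∈ K, L < N := by
        intro N hN
        refine lt_of_le_of_ne (hmin N fun p hp => hsupp p (hKs N hN p hp)) ?_
        rintro rfl
        exact hKs _ hN q hq hq'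
      have hLK : L ∉ K := fun h => lt_irrefl _ (hlt L h)
      obtain ⟨-, hK2, hK3⟩ := (isLayeringSimplex_iff ho).1 hK
      refine ⟨insert L K, Function.update d L (c q), (isLayeringSimplex_iff ho).2 ⟨?_, ?_, ?_⟩,
        ?_, ?_⟩
      · refine hclique.mono ?_
        rintro p ⟨N, hN, hpN⟩
        rcases Finset.mem_insert.1 hN with rfl | hN
        · exact hL p hpN
        · exact hsupp p (hKs N hN p hpN)
      · intro N hN M hM
        rcases Finset.mem_insert.1 hN with rfl | hNK
        · refine hmin M fun p hp => ?_
          obtain ⟨N', hN', -, hpN'⟩ := hM p hp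
          rcases Finset.mem_insert.1 hN' with rfl | hN'
          · exact hL p hpN'
          · exact hsupp p (hKs N' hN' p hpN')
        · refine hK2 N hNK M fun p hp => ?_
          obtain ⟨N', hN', hle, hpN'⟩ := hM p hp
          rcases Finset.mem_insert.1 hN' with rfl | hN'
          · exact absurd (hlt N hNK) (not_lt.2 hle)
          · exact ⟨N', hN', hle, hpN'⟩
      · intro N hN
        rcases Finset.mem_insert.1 hN with rfl | hNK
        -- The exhausted route `q` is the new route of `L`.
        · refine ⟨q, hq, fun N' hN' hlt' hqN' => ?_⟩
          rcases Finset.mem_insert.1 hN' with rfl | hN'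
          · exact lt_irrefl _ hlt'
          · exact hKs N' hN' q hqN' hq'
        · obtain ⟨p, hp, hnew⟩ := hK3 N hNK
          refine ⟨p, hp, fun N' hN' hlt' => ?_⟩
          rcases Finset.mem_insert.1 hN' with rfl | hN'
          · exact absurd (hlt N hNK) (lt_asymm hlt')
          · exact hnew N' hN' hlt'
      · intro N hN
        rcases Finset.mem_insert.1 hN with rfl | hNK
        · simpa using hcq
        · rw [Function.update_of_ne (hlt N hNK).ne']
          exact hd N hNK
      · intro p
        have h1 := hKc p
        rw [routeWeight] at h1 ⊢
        rw [Finset.sum_insert hLK, Function.update_self, Finset.sum_congr rfl fun N hN => by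
          rw [Function.update_of_ne (hlt N hN).ne'], h1]
        simp only [c']
        split_ifs <;> ring
    · intro s hs'
      simp only [c']
      rw [Finset.sum_sub_distrib, hs s hs', ← Finset.mul_sum, L.sum_start hs', mul_one]
    · intro j hj'
      simp only [c']
      rw [Finset.sum_sub_distrib, hj j hj', ← Finset.mul_sum, L.sum_finish hj']
      ring
    · refine Nat.le_of_lt_succ (lt_of_lt_of_le (Finset.card_lt_card ?_) hn)
      refine ⟨fun p hp => ?_, fun hsub => ?_⟩
      · simp only [Finset.mem_filter, Finset.mem_univ, true_and] at hp ⊢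
        exact hsupp p hp
      · have := @hsub q (by simpa using hcq.ne')
        simp [hq'] at this

end Framing

end DirectedMultigraph

/-! ### Faces of simplices -/

section Faces

variable {ι W : Type*} [AddCommGroup W] [Module ℝ W] {J : ι → W} {K : Finset ι}

theorem mem_convexHull_image_finset {x : W} :
    x ∈ convexHull ℝ (J '' K) ↔
      ∃ c : ι → ℝ, (∀ i ∈ K, 0 ≤ c i) ∧ ∑ i ∈ K, c i = 1 ∧ x = ∑ i ∈ K, c i • J i := by
  constructor
  · intro hx
    refine convexHull_min (t := {x | ∃ c : ι → ℝ, (∀ i ∈ K, 0 ≤ c i) ∧ ∑ i ∈ K, c i = 1 ∧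
      x = ∑ i ∈ K, c i • J i}) ?_ ?_ hx
    · rintro _ ⟨i, hi, rfl⟩
      refine ⟨Pi.single i 1, fun j _ => ?_, ?_, ?_⟩
      · rw [Pi.single_apply]
        split_ifs <;> simp
      · simpa [Pi.single_apply] using hi
      · have hi : i ∈ K := hi
        simp [Pi.single_apply, ite_smul, hi]
    · rintro _ ⟨c, hc, hc1, rfl⟩ _ ⟨d, hd, hd1, rfl⟩ s t hs ht hst
      refine ⟨fun i => s * c i + t * d i, fun i hi => ?_, ?_, ?_⟩
      · have := hc i hi
        have := hd i hi
        positivity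
      · rw [Finset.sum_add_distrib, ← Finset.mul_sum, ← Finset.mul_sum, hc1, hd1]
        linarith
      · simp only [add_smul, mul_smul, Finset.sum_add_distrib, Finset.smul_sum]
  · rintro ⟨c, hc, hc1, rfl⟩
    exact (convex_convexHull ℝ _).sum_mem hc hc1
      fun i hi => subset_convexHull ℝ _ ⟨i, hi, rfl⟩

variable [TopologicalSpace W]

/-- A convex combination attains the maximum of `l` only if it puts no mass on points where `l` is
smaller. Independence of the points plays no role here. -/
theorem exists_subset_of_isExposed {B : Set W} (hB : IsExposed ℝ (convexHull ℝ (J '' K)) B)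
    (hne : B.Nonempty) : ∃ K₁ ⊆ K, B = convexHull ℝ (J '' (K₁ : Set ι)) := by
  obtain ⟨l, rfl⟩ := hB hne
  obtain ⟨x₀, hx₀, -⟩ := hne
  have hKne : K.Nonempty := by
    rw [Finset.nonempty_iff_ne_empty]
    rintro rfl
    simp at hx₀
  obtain ⟨m, hm, hmax⟩ := K.exists_max_image (fun i => l (J i)) hKne
  have hmem : ∀ i ∈ K, J i ∈ convexHull ℝ (J '' K) :=
    fun i hi => subset_convexHull ℝ _ ⟨i, hi, rfl⟩
  have hle : ∀ x ∈ convexHull ℝ (J '' K), l x ≤ l (J m) := by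
    intro x hx
    obtain ⟨c, hc, hc1, rfl⟩ := mem_convexHull_image_finset.1 hx
    rw [map_sum]
    calc ∑ i ∈ K, l (c i • J i) ≤ ∑ i ∈ K, c i * l (J m) := by
          refine Finset.sum_le_sum fun i hi => ?_
          rw [map_smul, smul_eq_mul]
          exact mul_le_mul_of_nonneg_left (hmax i hi) (hc i hi)
      _ = l (J m) := by rw [← Finset.sum_mul, hc1, one_mul]
  refine ⟨K.filter fun i => l (J i) = l (J m), Finset.filter_subset _ _, ?_⟩
  ext x
  rw [mem_convexHull_image_finset]
  constructor
  · rintro ⟨hx, hxmax⟩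
    obtain ⟨c, hc, hc1, rfl⟩ := mem_convexHull_image_finset.1 hx
    have h1 := hxmax _ (hmem m hm)
    have h2 : ∑ i ∈ K, c i * (l (J m) - l (J i)) ≤ 0 := by
      simp only [map_sum, map_smul, smul_eq_mul] at h1
      simp only [mul_sub, Finset.sum_sub_distrib, ← Finset.sum_mul, hc1]
      linarith
    have h3 : ∀ i ∈ K, 0 ≤ c i * (l (J m) - l (J i)) :=
      fun i hi => mul_nonneg (hc i hi) (sub_nonneg.2 (hmax i hi))
    have h4 := (Finset.sum_eq_zero_iff_of_nonneg h3).1 (le_antisymm h2 (Finset.sum_nonneg h3))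
    have h5 : ∀ i ∈ K, l (J i) ≠ l (J m) → c i = 0 := fun i hi hne =>
      (mul_eq_zero.1 (h4 i hi)).resolve_right (sub_ne_zero.2 hne.symm)
    refine ⟨c, fun i hi => hc i (Finset.mem_filter.1 hi).1, ?_, ?_⟩
    · rw [Finset.sum_filter_of_ne, hc1]
      exact fun i hi hne => by_contra fun h => hne (h5 i hi h)
    · rw [Finset.sum_filter_of_ne]
      exact fun i hi hne => by_contra fun h => hne (by rw [h5 i hi h, zero_smul])
  · rintro ⟨c, hc, hc1, rfl⟩
    have hxv : l (∑ i ∈ K.filter (fun i => l (J i) = l (J m)), c i • J i) = l (J m) := by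
      rw [map_sum, Finset.sum_congr rfl fun i hi => by
        rw [map_smul, (Finset.mem_filter.1 hi).2, smul_eq_mul], ← Finset.sum_mul, hc1, one_mul]
    exact ⟨(convex_convexHull ℝ _).sum_mem hc hc1 fun i hi => hmem i (Finset.mem_filter.1 hi).1,
      fun y hy => by rw [hxv]; exact hle y hy⟩

/-- Linear independence provides a functional equal to `1` on the points of `K₁` and to `0` on the
others; it exposes the face. -/
theorem isExposed_of_subset [IsTopologicalAddGroup W] [ContinuousSMul ℝ W] [T2Space W]
    [FiniteDimensional ℝ W] (hJ : LinearIndependent ℝ fun i : K => J i) {K₁ : Finset ι}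
    (hK : K₁ ⊆ K) :
    IsExposed ℝ (convexHull ℝ (J '' K)) (convexHull ℝ (J '' (K₁ : Set ι))) := by
  rintro ⟨x₀, hx₀⟩
  obtain ⟨g, hg⟩ := LinearMap.exists_extend
    ((Module.Basis.span hJ).constr ℝ fun i : K => if (i : ι) ∈ K₁ then (1 : ℝ) else 0)
  have hgJ : ∀ i ∈ K, g (J i) = if i ∈ K₁ then 1 else 0 := by
    intro i hi
    have h1 := congrArg (fun f => f (Module.Basis.span hJ ⟨i, hi⟩)) hg
    simp only [Module.Basis.constr_basis, LinearMap.comp_apply, Submodule.subtype_apply] at h1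
    rw [Module.Basis.span_apply] at h1
    exact h1
  have hsum : ∀ c : ι → ℝ, g (∑ i ∈ K, c i • J i) = ∑ i ∈ K₁, c i := by
    intro c
    rw [map_sum, Finset.sum_congr rfl fun i hi => by rw [map_smul, hgJ i hi]]
    simp only [smul_eq_mul, mul_ite, mul_one, mul_zero]
    rw [← Finset.sum_filter, Finset.filter_mem_eq_inter, Finset.inter_eq_right.2 hK]
  have hle : ∀ x ∈ convexHull ℝ (J '' K), g x ≤ 1 := by
    intro x hx
    obtain ⟨c, hc, hc1, rfl⟩ := mem_convexHull_image_finset.1 hx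
    rw [hsum, ← hc1]
    exact Finset.sum_le_sum_of_subset_of_nonneg hK fun i hi _ => hc i hi
  have hsub : convexHull ℝ (J '' (K₁ : Set ι)) ⊆ convexHull ℝ (J '' K) :=
    convexHull_mono (Set.image_mono (by exact_mod_cast hK))
  have hone : ∀ x ∈ convexHull ℝ (J '' (K₁ : Set ι)), g x = 1 := by
    intro x hx
    obtain ⟨c, hc, hc1, rfl⟩ := mem_convexHull_image_finset.1 hx
    rw [map_sum, ← hc1]
    refine Finset.sum_congr rfl fun i hi => ?_
    rw [map_smul, hgJ i (hK hi), if_pos hi, smul_eq_mul, mul_one]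
  refine ⟨LinearMap.toContinuousLinearMap g, ?_⟩
  ext x
  constructor
  · intro hx
    refine ⟨hsub hx, fun y hy => ?_⟩
    simp only [LinearMap.coe_toContinuousLinearMap']
    rw [hone x hx]
    exact hle y hy
  · rintro ⟨hx, hmax⟩
    have h1 := hmax x₀ (hsub hx₀)
    simp only [LinearMap.coe_toContinuousLinearMap'] at h1
    rw [hone x₀ hx₀] at h1
    obtain ⟨c, hc, hc1, rfl⟩ := mem_convexHull_image_finset.1 hx
    rw [hsum] at h1
    have h2 := Finset.sum_sdiff (f := c) hK
    have h3 : ∀ i ∈ K \ K₁, 0 ≤ c i := fun i hi => hc i (Finset.mem_sdiff.1 hi).1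
    have h4 := (Finset.sum_eq_zero_iff_of_nonneg h3).1
      (le_antisymm (by linarith) (Finset.sum_nonneg h3))
    refine mem_convexHull_image_finset.2 ⟨c, fun i hi => hc i (hK hi), ?_, ?_⟩
    · rw [← hc1]
      exact Finset.sum_subset hK fun i hi hi' => h4 i (Finset.mem_sdiff.2 ⟨hi, hi'⟩)
    · refine (Finset.sum_subset hK fun i hi hi' => ?_).symm
      rw [h4 i (Finset.mem_sdiff.2 ⟨hi, hi'⟩), zero_smul]

end Faces

namespace DirectedMultigraph

variable {V E : Type*} {G : DirectedMultigraph V E} {a : V → ℤ}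

/-! ### Flow polytopes and layerings -/

theorem IsAcyclic.exists_isSource [Finite V] [Nonempty V] (hG : G.IsAcyclic) :
    ∃ s, G.IsSource s := by
  obtain ⟨t, ht⟩ := hG.exists_rank
  obtain ⟨s, hs⟩ := Finite.exists_min t
  refine ⟨s, fun e he => ?_⟩
  have h1 := ht e
  have h2 := hs (G.tail e)
  rw [he] at h1
  omega

theorem isFlow_of_mem [Fintype E] (ha : G.IsConservationist a) {F : E → ℝ}
    (hF : F ∈ G.flowPolytope a) : G.IsFlow F := by
  refine ⟨hF.1, fun v hv => ?_⟩
  have h1 := hF.2 v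
  rw [ha.internal v hv, Int.cast_zero] at h1
  linarith

theorem netflow_sum [Fintype E] [Fintype G.Route]
    (hG : ∃ t : V → ℕ, ∀ e, t (G.tail e) < t (G.head e)) (c : G.Route → ℝ) (v : V) :
    (∑ e with G.tail e = v, ∑ p, c p * p.indicator e) -
        ∑ e with G.head e = v, ∑ p, c p * p.indicator e =
      ∑ p with p.start = v, c p - ∑ p with p.finish = v, c p := by
  rw [Finset.sum_comm, Finset.sum_comm (s := Finset.univ.filter fun e => G.head e = v)]
  simp only [← Finset.mul_sum]
  rw [← Finset.sum_sub_distrib]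
  simp only [← mul_sub, Route.netflow hG]
  simp only [mul_sub, mul_ite, mul_one, mul_zero, Finset.sum_sub_distrib, Finset.sum_filter]

theorem sum_finish_of_isSource [Fintype G.Route] (hiso : ∀ v, G.IsSource v → ¬ G.IsSink v)
    (c : G.Route → ℝ) {s : V} (hs : G.IsSource s) : ∑ p with p.finish = s, c p = 0 := by
  rw [Finset.filter_false_of_mem, Finset.sum_empty]
  rintro p - rfl
  exact hiso _ hs p.isSink

theorem sum_start_of_isSink [Fintype G.Route] (hiso : ∀ v, G.IsSource v → ¬ G.IsSink v)
    (c : G.Route → ℝ) {j : V} (hj : G.IsSink j) : ∑ p with p.start = j, c p = 0 := by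
  rw [Finset.filter_false_of_mem, Finset.sum_empty]
  rintro p - rfl
  exact hiso _ p.isSource hj

theorem sum_start_of_mem [Finite V] [Fintype E] [Fintype G.Route] (hG : G.IsAcyclic)
    (ha : G.IsConservationist a) {c : G.Route → ℝ} {F : E → ℝ} (hF : F ∈ G.flowPolytope a)
    (hc : ∀ e, ∑ p, c p * p.indicator e = F e) {s : V} (hs : G.IsSource s) :
    ∑ p with p.start = s, c p = 1 := by
  have h1 := netflow_sum hG.exists_rank c s
  simp only [hc] at h1
  have h2 := hF.2 s
  rw [ha.source s hs, Int.cast_one] at h2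
  rw [sum_finish_of_isSource ha.not_isSink c hs] at h1
  linarith

theorem sum_finish_of_mem [Finite V] [Fintype E] [Fintype G.Route] (hG : G.IsAcyclic)
    (ha : G.IsConservationist a) {c : G.Route → ℝ} {F : E → ℝ} (hF : F ∈ G.flowPolytope a)
    (hc : ∀ e, ∑ p, c p * p.indicator e = F e) {j : V} (hj : G.IsSink j) :
    ∑ p with p.finish = j, c p = |a j| := by
  have h1 := netflow_sum hG.exists_rank c j
  simp only [hc] at h1
  have h2 := hF.2 j
  rw [sum_start_of_isSink ha.not_isSink c hj] at h1
  rw [abs_of_neg (ha.sink j hj), Int.cast_neg]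
  linarith

theorem Layering.indicator_apply [Fintype G.Route] (L : G.Layering a) (e : E) :
    L.indicator e = ∑ p, (if p ∈ L.routes then 1 else 0) * p.indicator e := by
  simp [Layering.indicator, ite_mul]

theorem Layering.indicator_mem [Finite V] [Fintype E] [Fintype G.Route] (hG : G.IsAcyclic)
    (ha : G.IsConservationist a) (L : G.Layering a) : L.indicator ∈ G.flowPolytope a := by
  refine ⟨fun e => ?_, fun v => ?_⟩
  · rw [L.indicator_apply]
    refine Finset.sum_nonneg fun p _ => mul_nonneg ?_ (p.indicator_nonneg e)
    split_ifs <;> simp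
  · simp only [L.indicator_apply]
    rw [netflow_sum hG.exists_rank]
    by_cases hs : G.IsSource v
    · rw [L.sum_start hs, sum_finish_of_isSource ha.not_isSink _ hs, ha.source v hs]
      simp
    by_cases hj : G.IsSink v
    · rw [L.sum_finish hj, sum_start_of_isSink ha.not_isSink _ hj, abs_of_neg (ha.sink v hj)]
      simp
    · rw [ha.internal v ⟨hs, hj⟩, Finset.filter_false_of_mem, Finset.filter_false_of_mem]
      · simp
      · rintro p - rfl
        exact hj p.isSink
      · rintro p - rfl
        exact hs p.isSource

theorem Layering.isIntegerPoint_indicator [Fintype G.Route] (L : G.Layering a) :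
    IsIntegerPoint L.indicator := by
  intro e
  rw [L.indicator_apply]
  have : ∀ p : G.Route, ((if p ∈ L.routes then 1 else 0) * p.indicator e : ℝ) =
      ((if p ∈ L.routes ∧ e ∈ p.edges then 1 else 0 : ℤ) : ℝ) := by
    intro p
    simp only [Route.indicator]
    split_ifs <;> simp_all
  exact ⟨∑ p : G.Route, if p ∈ L.routes ∧ e ∈ p.edges then 1 else 0, by
    rw [Int.cast_sum]
    exact Finset.sum_congr rfl fun p _ => this p⟩

theorem convex_flowPolytope [Fintype E] : Convex ℝ (G.flowPolytope a) := by
  rintro x ⟨hx0, hx⟩ y ⟨hy0, hy⟩ s t hs ht hst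
  refine ⟨fun e => ?_, fun v => ?_⟩
  · have := hx0 e
    have := hy0 e
    simp only [Pi.add_apply, Pi.smul_apply, smul_eq_mul]
    positivity
  · simp only [Pi.add_apply, Pi.smul_apply, smul_eq_mul, Finset.sum_add_distrib,
      ← Finset.mul_sum]
    have h1 := hx v
    have h2 := hy v
    calc _ = s * ((∑ e with G.tail e = v, x e) - ∑ e with G.head e = v, x e) +
          t * ((∑ e with G.tail e = v, y e) - ∑ e with G.head e = v, y e) := by ring
      _ = (s + t) * a v := by rw [h1, h2]; ring
      _ = a v := by rw [hst, one_mul]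

theorem sum_smul_indicator_apply {K : Finset (G.Layering a)} (y : G.Layering a → ℝ) (e : E) :
    (∑ L ∈ K, y L • L.indicator) e = ∑ L ∈ K, y L * L.indicator e := by
  simp

/-- At any one source an `a`-flow has outflow `1`, and each layering contributes exactly one route
there. The signs of the coefficients do not matter. -/
theorem sum_coeff_eq_one [Finite V] [Nonempty V] [Fintype E] [Fintype G.Route] (hG : G.IsAcyclic)
    (ha : G.IsConservationist a) {K : Finset (G.Layering a)} {y : G.Layering a → ℝ}
    (h : ∑ L ∈ K, y L • L.indicator ∈ G.flowPolytope a) : ∑ L ∈ K, y L = 1 := by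
  obtain ⟨s, hs⟩ := hG.exists_isSource
  have h1 := sum_start_of_mem hG ha h (c := Framing.routeWeight K y)
    (fun e => by rw [sum_smul_indicator_apply, Framing.sum_indicator]) hs
  rw [← h1]
  simp only [Framing.routeWeight]
  rw [Finset.sum_comm]
  refine Finset.sum_congr rfl fun L _ => ?_
  have := congrArg (y L * ·) (L.sum_start hs)
  simp only [Finset.mul_sum, mul_ite, mul_one, mul_zero] at this
  exact this.symm

theorem polyhedralSimplex_eq [Finite V] [Nonempty V] [Fintype E] [Fintype G.Route]
    (hG : G.IsAcyclic) (ha : G.IsConservationist a) (K : Finset (G.Layering a)) :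
    polyhedralSimplex K = convexHull ℝ (Layering.indicator '' (K : Set (G.Layering a))) := by
  ext F
  rw [mem_convexHull_image_finset]
  constructor
  · rintro ⟨hF, c, hc, rfl⟩
    exact ⟨c, hc, sum_coeff_eq_one hG ha hF, rfl⟩
  · rintro ⟨c, hc, hc1, rfl⟩
    exact ⟨convex_flowPolytope.sum_mem hc hc1 fun L _ => L.indicator_mem hG ha, c, hc, rfl⟩

/-! ### The layering-simplices triangulate the flow polytope -/

namespace Framing

variable {Φ : G.Framing}

theorem exists_simplex_of_mem [Fintype V] [Nonempty V] [Fintype E] [Fintype G.Route]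
    (hG : G.IsAcyclic) (ha : G.IsConservationist a) (Φ : G.Framing) {F : E → ℝ}
    (hF : F ∈ G.flowPolytope a) :
    ∃ K : Finset (G.Layering a), Φ.IsLayeringSimplex K ∧ F ∈ polyhedralSimplex K := by
  obtain ⟨o, ho⟩ := exists_linearOrder hG Φ a
  obtain ⟨c, h0, hclique, hc⟩ := (isFlow_of_mem ha hF).exists_decomposition hG ha.not_isSink Φ
  obtain ⟨K, d, hK, hd, hKc⟩ := exists_layeringSimplex hG.exists_isSource ho _ h0 hclique (x := 1)
    (fun s hs => sum_start_of_mem hG ha hF hc hs)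
    (fun j hj => by rw [sum_finish_of_mem hG ha hF hc hj, one_mul]) le_rfl
  refine ⟨K, hK, hF, d, fun L hL => (hd L hL).le, funext fun e => ?_⟩
  rw [sum_smul_indicator_apply, sum_indicator, ← hc e]
  simp only [hKc]

/-- Joins the two uniqueness results: the flow determines the route weights, and these determine the
set of layerings. -/
theorem IsLayeringSimplex.eq_of_sum_eq [Fintype V] [Fintype E] [Fintype G.Route]
    (hG : G.IsAcyclic) (ha : G.IsConservationist a) {K K' : Finset (G.Layering a)}
    (hK : Φ.IsLayeringSimplex K) (hK' : Φ.IsLayeringSimplex K') {d d' : G.Layering a → ℝ}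
    (hd : ∀ L ∈ K, 0 < d L) (hd' : ∀ L ∈ K', 0 < d' L)
    (h : ∑ L ∈ K, d L • L.indicator = ∑ L ∈ K', d' L • L.indicator) : K = K' := by
  obtain ⟨o, ho⟩ := exists_linearOrder hG Φ a
  refine hK.unique ho K.card hK' hd hd' (fun p => ?_) le_rfl
  have h1 := coefficient_eq (Φ := Φ) hG ha.not_isSink
    (routeWeight_nonneg fun L hL => (hd L hL).le) (hK.clique.mono fun p hp => routeWeight_mem hp)
    (F := ∑ L ∈ K, d L • L.indicator) (fun e => by rw [sum_smul_indicator_apply, sum_indicator]) p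
  have h2 := coefficient_eq (Φ := Φ) hG ha.not_isSink
    (routeWeight_nonneg fun L hL => (hd' L hL).le) (hK'.clique.mono fun p hp => routeWeight_mem hp)
    (F := ∑ L ∈ K', d' L • L.indicator) (fun e => by rw [sum_smul_indicator_apply, sum_indicator]) p
  rw [h1, h2, h]

/-- A linear relation has zero route weights, because the routes of a clique are independent, and
then `coeff_mem` applies with the trivial group. -/
theorem IsLayeringSimplex.linearIndependent [Fintype V] [Fintype E] [Fintype G.Route]
    (hG : G.IsAcyclic) (ha : G.IsConservationist a) {K : Finset (G.Layering a)}
    (hK : Φ.IsLayeringSimplex K) :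
    LinearIndependent ℝ fun L : K => (L : G.Layering a).indicator := by
  obtain ⟨o, ho⟩ := exists_linearOrder hG Φ a
  have : Finite (G.Layering a) := Layering.finite inferInstance
  rw [linearIndependent_iff']
  intro s g hg L hL
  let y : G.Layering a → ℝ := fun N => if h : ∃ hN : N ∈ K, (⟨N, hN⟩ : K) ∈ s then g ⟨N, h.1⟩ else 0
  have hyK : ∑ N ∈ K, y N • N.indicator = 0 := by
    rw [← hg, ← Finset.sum_coe_sort K, ← Finset.sum_filter_add_sum_filter_not _ (· ∈ s)]
    rw [Finset.sum_eq_zero (s := Finset.univ.filter fun x => ¬ x ∈ s), add_zero]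
    · rw [Finset.filter_univ_mem]
      refine Finset.sum_congr rfl fun N hN => ?_
      have : ∃ hN : N.1 ∈ K, (⟨N, hN⟩ : K) ∈ s := ⟨N.2, hN⟩
      simp only [y, dif_pos this]
    · intro N hN
      have : ¬ ∃ hN : N.1 ∈ K, (⟨N, hN⟩ : K) ∈ s := fun ⟨_, h⟩ => (Finset.mem_filter.1 hN).2 h
      simp only [y, dif_neg this, zero_smul]
  have h1 := hK.clique.eq_zero hG ha.not_isSink (c := routeWeight K y)
    (fun p hp => routeWeight_mem hp) fun e => by
      rw [← sum_indicator, ← sum_smul_indicator_apply, hyK]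
      rfl
  have h2 := hK.coeff_mem ho (y := y) (H := ⊥) (fun p => by rw [h1]; exact zero_mem _) L L.2
  have h3 : ∃ hN : L.1 ∈ K, (⟨L, hN⟩ : K) ∈ s := ⟨L.2, hL⟩
  simp only [y, dif_pos h3] at h2
  exact h2

/-- Integrality passes from the flow to the route weights and from these, by the unitriangular
system, to the coefficients. -/
theorem IsLayeringSimplex.isInteger [Fintype V] [Fintype E] [Fintype G.Route]
    (hG : G.IsAcyclic) (ha : G.IsConservationist a) {K : Finset (G.Layering a)}
    (hK : Φ.IsLayeringSimplex K) {y : G.Layering a → ℝ}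
    (hy : IsIntegerPoint (∑ L ∈ K, y L • L.indicator)) : ∀ L ∈ K, ∃ n : ℤ, y L = n := by
  obtain ⟨o, ho⟩ := exists_linearOrder hG Φ a
  have : Finite (G.Layering a) := Layering.finite inferInstance
  have h1 := hK.clique.isInteger hG ha.not_isSink (c := routeWeight K y)
    (fun p hp => routeWeight_mem hp) fun e => by
      rw [← sum_indicator, ← sum_smul_indicator_apply]
      obtain ⟨n, hn⟩ := hy e
      exact ⟨n, hn.symm⟩
  intro L hL
  obtain ⟨n, hn⟩ := hK.coeff_mem ho h1 L hL
  exact ⟨n, hn.symm⟩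

/-- For a common point, discarding zero coefficients on either side gives two layering-simplices
with positive coefficients; they are equal by uniqueness, so they lie in `K ∩ L`. -/
theorem polyhedralSimplex_inter [Fintype V] [Fintype E] [Fintype G.Route]
    (hG : G.IsAcyclic) (ha : G.IsConservationist a) {K L : Finset (G.Layering a)}
    (hK : Φ.IsLayeringSimplex K) (hL : Φ.IsLayeringSimplex L) :
    polyhedralSimplex K ∩ polyhedralSimplex L = polyhedralSimplex (K ∩ L) := by
  have hmono : ∀ {K K' : Finset (G.Layering a)}, K ⊆ K' →
      polyhedralSimplex K ⊆ polyhedralSimplex K' := by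
    rintro K K' h F ⟨hF, c, hc, rfl⟩
    refine ⟨hF, fun L => if L ∈ K then c L else 0, fun L _ => ?_, ?_⟩
    · simp only
      split_ifs with hL
      · exact hc L hL
      · exact le_rfl
    · simp only [ite_smul, zero_smul]
      rw [← Finset.sum_filter, Finset.filter_mem_eq_inter, Finset.inter_eq_right.2 h]
  have hpos : ∀ {K : Finset (G.Layering a)} {c : G.Layering a → ℝ}, (∀ L ∈ K, 0 ≤ c L) →
      (∀ L ∈ K.filter fun L => c L ≠ 0, 0 < c L) ∧
      ∑ L ∈ K.filter (fun L => c L ≠ 0), c L • L.indicator = ∑ L ∈ K, c L • L.indicator := by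
    intro K c hc
    refine ⟨fun L hL => ?_, ?_⟩
    · obtain ⟨h1, h2⟩ := Finset.mem_filter.1 hL
      exact (hc L h1).lt_of_ne' h2
    · refine Finset.sum_filter_of_ne fun L _ hne h => hne ?_
      rw [h, zero_smul]
  refine Set.Subset.antisymm ?_
    (Set.subset_inter (hmono Finset.inter_subset_left) (hmono Finset.inter_subset_right))
  rintro F ⟨⟨hF, c, hc, rfl⟩, -, d, hd, hFd⟩
  obtain ⟨hc1, hc2⟩ := hpos hc
  obtain ⟨hd1, hd2⟩ := hpos hd
  have heq := (hK.mono (Finset.filter_subset _ _)).eq_of_sum_eq hG ha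
    (hL.mono (Finset.filter_subset _ _)) hc1 hd1 (by rw [hc2, hd2, hFd])
  refine hmono (K := K.filter fun L => c L ≠ 0) ?_ ⟨hF, c, fun L hL => (hc1 L hL).le, hc2.symm⟩
  refine Finset.subset_inter (Finset.filter_subset _ _) ?_
  rw [heq]
  exact Finset.filter_subset _ _

theorem isLatticeTriangulation [Fintype V] [Nonempty V] [Fintype E] [Fintype G.Route]
    (hG : G.IsAcyclic) (ha : G.IsConservationist a) (Φ : G.Framing) :
    IsLatticeTriangulation (G.flowPolytope a) (framingTriangulation a Φ) := by
  have hfin : Finite (G.Layering a) := Layering.finite inferInstance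
  have := Fintype.ofFinite (G.Layering a)
  have hempty : Φ.IsLayeringSimplex (∅ : Finset (G.Layering a)) :=
    ⟨by rintro p ⟨L, hL, -⟩; simp at hL, by simp, by simp⟩
  have hexp : ∀ {K K₁ : Finset (G.Layering a)}, Φ.IsLayeringSimplex K → K₁ ⊆ K →
      IsExposed ℝ (polyhedralSimplex K) (polyhedralSimplex K₁) := by
    intro K K₁ hK h
    rw [polyhedralSimplex_eq hG ha, polyhedralSimplex_eq hG ha]
    exact isExposed_of_subset (hK.linearIndependent hG ha) h
  refine ⟨⟨Finset.univ.image (Layering.indicator (G := G) (a := a)), ?_, ?_⟩, ?_, ?_, ?_, ?_, ?_⟩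
  · intro v hv
    obtain ⟨L, -, rfl⟩ := Finset.mem_image.1 hv
    exact L.isIntegerPoint_indicator
  · refine Set.Subset.antisymm (fun F hF => ?_) (convexHull_min ?_ convex_flowPolytope)
    · obtain ⟨K, hK, hFK⟩ := exists_simplex_of_mem hG ha Φ hF
      rw [polyhedralSimplex_eq hG ha] at hFK
      refine convexHull_mono ?_ hFK
      rintro _ ⟨L, -, rfl⟩
      simp
    · intro v hv
      simp only [Finset.coe_image, Finset.coe_univ, Set.image_univ, Set.mem_range] at hv
      obtain ⟨L, rfl⟩ := hv
      exact L.indicator_mem hG ha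
  · refine (Set.finite_range fun K : Finset (G.Layering a) => polyhedralSimplex K).subset ?_
    rintro _ ⟨K, -, rfl⟩
    exact ⟨K, rfl⟩
  · rintro _ ⟨K, hK, rfl⟩
    refine ⟨K.image Layering.indicator, ?_, ?_, ?_⟩
    · intro v hv
      obtain ⟨L, -, rfl⟩ := Finset.mem_image.1 hv
      exact L.isIntegerPoint_indicator
    · have h1 := (hK.linearIndependent hG ha).affineIndependent.range
      refine h1.mono ?_
      intro v hv
      obtain ⟨L, hL, rfl⟩ := Finset.mem_image.1 hv
      exact ⟨⟨L, hL⟩, rfl⟩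
    · rw [polyhedralSimplex_eq hG ha, Finset.coe_image]
  · refine Set.Subset.antisymm (fun F hF => ?_) ?_
    · obtain ⟨K, hK, hFK⟩ := exists_simplex_of_mem hG ha Φ hF
      exact ⟨_, ⟨K, hK, rfl⟩, hFK⟩
    · rintro F ⟨_, ⟨K, hK, rfl⟩, hFK⟩
      exact hFK.1
  · rintro _ ⟨K, hK, rfl⟩ S' hS'
    rcases S'.eq_empty_or_nonempty with rfl | hne
    · refine ⟨∅, hempty, ?_⟩
      rw [polyhedralSimplex_eq hG ha]
      simp
    · rw [polyhedralSimplex_eq hG ha] at hS'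
      obtain ⟨K₁, hK₁, rfl⟩ := exists_subset_of_isExposed hS' hne
      exact ⟨K₁, hK.mono hK₁, (polyhedralSimplex_eq hG ha K₁).symm⟩
  · rintro _ ⟨K, hK, rfl⟩ _ ⟨L, hL, rfl⟩
    rw [polyhedralSimplex_inter hG ha hK hL]
    exact ⟨hexp hK Finset.inter_subset_left, hexp hL Finset.inter_subset_right⟩

end Framing

end DirectedMultigraph

/-! ### The normalized volume of a unimodular simplex -/

section Volume

open MeasureTheory

/-- The volume of a corner simplex. -/
theorem volume_cornerSimplex_fin (n : ℕ) {t : ℝ} (ht : 0 ≤ t) :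
    volume {x : Fin n → ℝ | (∀ i, 0 ≤ x i) ∧ ∑ i, x i ≤ t} =
      ENNReal.ofReal (t ^ n / n.factorial) := by
  induction n generalizing t with
  | zero =>
    have : {x : Fin 0 → ℝ | (∀ i, 0 ≤ x i) ∧ ∑ i, x i ≤ t} = Set.univ := by
      ext x
      simp [ht]
    rw [this, volume_pi, Measure.pi_univ]
    simp
  | succ n ih =>
    have hmeas : ∀ m : ℕ, MeasurableSet {x : Fin m → ℝ | (∀ i, 0 ≤ x i) ∧ ∑ i, x i ≤ t} := by
      intro m
      refine IsClosed.measurableSet ?_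
      simp only [Set.ofPred_and, Set.ofPred_forall]
      exact (isClosed_iInter fun i => isClosed_le continuous_const (continuous_apply i)).inter
        (isClosed_le (by fun_prop) continuous_const)
    have hmp := (volume_preserving_piFinSuccAbove (fun _ : Fin (n + 1) => ℝ) 0).symm
    rw [← hmp.measure_preimage (hmeas _).nullMeasurableSet, Measure.volume_eq_prod,
      Measure.prod_apply ((hmeas _).preimage hmp.measurable)]
    -- The slice at first coordinate `x` is a corner simplex of size `t - x`, empty unless `x` is in
    -- `[0, t]`.
    have hsec : ∀ x : ℝ, volume (Prod.mk x ⁻¹'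
        ((MeasurableEquiv.piFinSuccAbove (fun _ : Fin (n + 1) => ℝ) 0).symm ⁻¹'
          {x : Fin (n + 1) → ℝ | (∀ i, 0 ≤ x i) ∧ ∑ i, x i ≤ t})) =
        (Set.Icc 0 t).indicator (fun x => ENNReal.ofReal ((t - x) ^ n / n.factorial)) x := by
      intro x
      have hset : (Prod.mk x ⁻¹'
        ((MeasurableEquiv.piFinSuccAbove (fun _ : Fin (n + 1) => ℝ) 0).symm ⁻¹'
          {x : Fin (n + 1) → ℝ | (∀ i, 0 ≤ x i) ∧ ∑ i, x i ≤ t})) =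
          {y : Fin n → ℝ | 0 ≤ x ∧ (∀ i, 0 ≤ y i) ∧ ∑ i, y i ≤ t - x} := by
        ext y
        simp [MeasurableEquiv.piFinSuccAbove, Fin.forall_fin_succ, Fin.sum_univ_succ, and_assoc,
          le_sub_iff_add_le, add_comm]
      rw [hset]
      by_cases hx : x ∈ Set.Icc 0 t
      · rw [Set.indicator_of_mem hx, ← ih (sub_nonneg.2 hx.2)]
        congr 1
        ext y
        simp [hx.1]
      · rw [Set.indicator_of_notMem hx]
        convert measure_empty (μ := volume (α := Fin n → ℝ))
        ext y
        refine iff_of_false ?_ (by simp)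
        rintro ⟨h1, h2, h3⟩
        have := Finset.sum_nonneg fun i (_ : i ∈ Finset.univ) => h2 i
        exact hx ⟨h1, by linarith⟩
    simp only [hsec]
    rw [lintegral_indicator measurableSet_Icc, ← ofReal_integral_eq_lintegral_ofReal]
    · congr 1
      rw [integral_Icc_eq_integral_Ioc, ← intervalIntegral.integral_of_le ht,
        intervalIntegral.integral_div, intervalIntegral.integral_comp_sub_left (fun x => x ^ n),
        integral_pow, sub_self, sub_zero, Nat.factorial_succ]
      push_cast
      field_simp
      simp
    · exact (Continuous.continuousOn (by fun_prop)).integrableOn_Icc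
    · refine (ae_restrict_iff' measurableSet_Icc).2 (Filter.Eventually.of_forall fun x hx => ?_)
      have := sub_nonneg.2 hx.2
      positivity

theorem volume_cornerSimplex (κ : Type*) [Fintype κ] :
    volume {x : κ → ℝ | (∀ i, 0 ≤ x i) ∧ ∑ i, x i ≤ 1} =
      ENNReal.ofReal (1 / (Fintype.card κ).factorial) := by
  have h := volume_cornerSimplex_fin (Fintype.card κ) zero_le_one
  rw [one_pow] at h
  let e := (Fintype.equivFin κ).symm
  have hmp := volume_measurePreserving_piCongrLeft (fun _ : κ => ℝ) e
  rw [← h, ← hmp.measure_preimage_equiv]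
  congr 1
  ext x
  have hx : ∀ i, MeasurableEquiv.piCongrLeft (fun _ : κ => ℝ) e x (e i) = x i :=
    fun i => MeasurableEquiv.piCongrLeft_apply_apply (β := fun _ : κ => ℝ) e x i
  simp only [Set.mem_preimage, Set.mem_ofPred_eq]
  rw [← e.sum_comp, ← e.forall_congr_right
    (q := fun i => 0 ≤ MeasurableEquiv.piCongrLeft (fun _ : κ => ℝ) e x i)]
  simp only [hx]

/-- In the coordinates of a lattice basis, Haar measure is a multiple of Lebesgue measure and the
fundamental domain is the unit cube. The multiple cancels in the quotient. -/
theorem latticeVolume_cornerSimplex {E κ : Type*} [Fintype E] [Fintype κ]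
    {D : Submodule ℝ (E → ℝ)} (b : Module.Basis κ ℝ D)
    (hb : integerPointsIn D = Submodule.span ℤ (Set.range b)) :
    latticeVolume D {w | (∀ i, 0 ≤ b.repr w i) ∧ ∑ i, b.repr w i ≤ 1} =
      1 / (Fintype.card κ).factorial := by
  let μ : Measure D := Measure.addHaar
  let φ : D ≃L[ℝ] (κ → ℝ) := b.equivFunL
  have hφ : ∀ w i, φ w i = b.repr w i := fun w i => rfl
  let ν : Measure (κ → ℝ) := μ.map φ
  have : ν.IsAddHaarMeasure := φ.isAddHaarMeasure_map μ
  obtain ⟨r, hr0, hr⟩ : ∃ r : NNReal, r ≠ 0 ∧ ν = r • volume :=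
    ⟨_, (Measure.addHaarScalarFactor_pos_of_isAddHaarMeasure ν volume).ne',
      Measure.isAddLeftInvariant_eq_smul ν volume⟩
  have hpre : ∀ B : Set (κ → ℝ), μ.real (φ ⁻¹' B) = r * volume.real B := by
    intro B
    have h1 : ν B = μ (φ ⁻¹' B) := φ.toHomeomorph.toMeasurableEquiv.map_apply B
    rw [measureReal_def, ← h1, hr]
    simp [measureReal_def]
  have hfd : ZSpan.fundamentalDomain b = φ ⁻¹' (Set.pi Set.univ fun _ => Set.Ico 0 1) := by
    ext w
    simp [ZSpan.mem_fundamentalDomain, hφ]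
  have hsimp : {w | (∀ i, 0 ≤ b.repr w i) ∧ ∑ i, b.repr w i ≤ 1} =
      φ ⁻¹' {x | (∀ i, 0 ≤ x i) ∧ ∑ i, x i ≤ 1} := rfl
  have hcov : ZLattice.covolume (integerPointsIn D) μ = μ.real (ZSpan.fundamentalDomain b) := by
    rw [hb]
    exact ZLattice.covolume_eq_measure_fundamentalDomain _ μ (ZSpan.isAddFundamentalDomain b μ)
  change μ.real _ / ZLattice.covolume (integerPointsIn D) μ = _
  have hcube : volume.real (Set.pi Set.univ fun _ : κ => Set.Ico (0 : ℝ) 1) = 1 := by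
    rw [measureReal_def, Real.volume_pi_Ico]
    simp
  rw [hcov, hfd, hsimp, hpre, hpre, hcube, measureReal_def, volume_cornerSimplex,
    ENNReal.toReal_ofReal (by positivity), mul_one]
  have : (r : ℝ) ≠ 0 := by exact_mod_cast hr0
  field_simp

theorem vectorSpan_convexHull_range {ι W : Type*} [AddCommGroup W] [Module ℝ W] (v : ι → W) :
    vectorSpan ℝ (convexHull ℝ (Set.range v)) = vectorSpan ℝ (Set.range v) := by
  rw [← direction_affineSpan, affineSpan_convexHull, direction_affineSpan]

/-- A simplex has normalized volume `1` if its integer affine combinations have integer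
coefficients. -/
theorem normalizedVolume_convexHull_range {E ι : Type*} [Fintype E] [Fintype ι] [Nonempty ι]
    {v : ι → E → ℝ} (hv : AffineIndependent ℝ v) (hint : ∀ i, IsIntegerPoint (v i))
    (hcoeff : ∀ y : ι → ℝ, ∑ i, y i = 1 → IsIntegerPoint (∑ i, y i • v i) →
      ∀ i, ∃ n : ℤ, y i = n) :
    normalizedVolume (convexHull ℝ (Set.range v)) = 1 := by
  obtain ⟨i₀⟩ := ‹Nonempty ι›
  let κ := {i : ι // i ≠ i₀}
  set S := convexHull ℝ (Set.range v) with hS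
  have hne : S.Nonempty := ⟨v i₀, subset_convexHull ℝ _ ⟨i₀, rfl⟩⟩
  have hli := (affineIndependent_iff_linearIndependent_vsub ℝ v i₀).1 hv
  have hspan : vectorSpan ℝ S = Submodule.span ℝ (Set.range fun i : κ => v i -ᵥ v i₀) := by
    rw [hS, vectorSpan_convexHull_range, vectorSpan_range_eq_span_range_vsub_right_ne ℝ v i₀]
  obtain ⟨b, hb⟩ : ∃ b : Module.Basis κ ℝ (vectorSpan ℝ S),
      ∀ i : κ, (b i : E → ℝ) = v i - v i₀ := by
    rw [hspan]
    exact ⟨Module.Basis.span hli, fun i => congrArg Subtype.val (Module.Basis.span_apply hli i)⟩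
  have hrepr : ∀ w : vectorSpan ℝ S, ∀ r : κ → ℝ,
      (w : E → ℝ) = ∑ i, r i • (v i - v i₀) ↔ ∀ i, b.repr w i = r i := by
    intro w r
    have h1 : ∑ i, r i • (v i - v i₀) = ((∑ i, r i • b i : vectorSpan ℝ S) : E → ℝ) := by
      simp [hb]
    rw [h1, SetLike.coe_eq_coe]
    constructor
    · rintro rfl i
      rw [b.repr_sum_self]
    · intro h
      rw [← b.sum_repr w]
      simp only [h]
  have hcomb : ∀ y : ι → ℝ, ∑ i, y i = 1 →
      ∑ i, y i • v i = v i₀ + ∑ i : κ, y i • (v i - v i₀) := by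
    intro y hy
    have h1 : ∑ i : κ, y i • (v i - v i₀) = ∑ i, y i • (v i - v i₀) := by
      rw [Fintype.sum_eq_add_sum_subtype_ne _ i₀, sub_self, smul_zero, zero_add]
    rw [h1]
    simp only [smul_sub, Finset.sum_sub_distrib, ← Finset.sum_smul, hy, one_smul]
    abel
  have hext : ∀ r : κ → ℝ, ∃ y : ι → ℝ, (∀ i : κ, y i = r i) ∧ y i₀ = 1 - ∑ i, r i ∧
      ∑ i, y i = 1 := by
    intro r
    let y : ι → ℝ := fun i => if h : i ≠ i₀ then r ⟨i, h⟩ else 1 - ∑ i, r i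
    have h1 : ∀ i : κ, y i = r i := fun i => dif_pos i.2
    have h2 : y i₀ = 1 - ∑ i, r i := dif_neg (by simp)
    refine ⟨y, h1, h2, ?_⟩
    rw [Fintype.sum_eq_add_sum_subtype_ne _ i₀, h2]
    simp only [κ] at h1
    simp [h1, κ]
  -- The coordinates of a lattice vector `w` are coefficients in the affine combination `v i₀ + w`,
  -- an integer point, so `hcoeff` makes them integers.
  have hlat : integerPointsIn (vectorSpan ℝ S) = Submodule.span ℤ (Set.range b) := by
    refine le_antisymm (fun w hw => ?_) (Submodule.span_le.2 ?_)
    · rw [b.mem_span_iff_repr_mem ℤ]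
      intro i
      obtain ⟨y, hy, -, hy1⟩ := hext fun i => b.repr w i
      have h1 := hcoeff y hy1 ?_ i
      · obtain ⟨n, hn⟩ := h1
        refine ⟨n, ?_⟩
        rw [← hy i, hn]
        simp
      · rw [hcomb y hy1]
        simp only [hy]
        rw [← (hrepr w fun i => b.repr w i).2 fun i => rfl]
        intro e
        obtain ⟨m, hm⟩ := hint i₀ e
        obtain ⟨n, hn⟩ := hw e
        exact ⟨m + n, by simp [hm, hn]⟩
    · rintro _ ⟨i, rfl⟩ e
      obtain ⟨m, hm⟩ := hint i e
      obtain ⟨n, hn⟩ := hint i₀ e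
      exact ⟨m - n, by rw [hb]; simp [hm, hn]⟩
  have hset : {w : vectorSpan ℝ S | v i₀ + (w : E → ℝ) ∈ S} =
      {w | (∀ i, 0 ≤ b.repr w i) ∧ ∑ i, b.repr w i ≤ 1} := by
    have hmem : ∀ x, x ∈ S ↔ ∃ c : ι → ℝ, (∀ i, 0 ≤ c i) ∧ ∑ i, c i = 1 ∧ x = ∑ i, c i • v i := by
      intro x
      have := mem_convexHull_image_finset (J := v) (K := Finset.univ) (x := x)
      simpa using this
    ext w
    simp only [Set.mem_ofPred_eq, hmem]
    constructor
    · rintro ⟨c, hc, hc1, hw⟩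
      rw [hcomb c hc1] at hw
      have h1 := (hrepr w fun i => c i).1 (add_left_cancel hw)
      refine ⟨fun i => by rw [h1]; exact hc i, ?_⟩
      simp only [h1]
      rw [Fintype.sum_eq_add_sum_subtype_ne _ i₀] at hc1
      have := hc i₀
      simp only [κ]
      linarith
    · rintro ⟨h1, h2⟩
      obtain ⟨y, hy, hy0, hy1⟩ := hext fun i => b.repr w i
      refine ⟨y, fun i => ?_, hy1, ?_⟩
      · by_cases hi : i = i₀
        · rw [hi, hy0]
          linarith
        · have := hy ⟨i, hi⟩
          simp only at this
          rw [this]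
          exact h1 _
      · rw [hcomb y hy1]
        simp only [hy]
        rw [← (hrepr w fun i => b.repr w i).2 fun i => rfl]
  have hδ : hne.some - v i₀ ∈ vectorSpan ℝ S :=
    vsub_mem_vectorSpan ℝ hne.some_mem (subset_convexHull ℝ _ ⟨i₀, rfl⟩)
  -- The base point in `normalizedVolume` is arbitrary; translation to the vertex `v i₀` does not
  -- change Haar measure.
  have htrans : {w : vectorSpan ℝ S | hne.some + (w : E → ℝ) ∈ S} =
      (fun w => (⟨_, hδ⟩ : vectorSpan ℝ S) + w) ⁻¹'
        {w : vectorSpan ℝ S | v i₀ + (w : E → ℝ) ∈ S} := by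
    ext w
    simp only [Set.mem_preimage, Set.mem_ofPred_eq, Submodule.coe_add]
    rw [← add_assoc, add_sub_cancel]
  have hvol := latticeVolume_cornerSimplex b hlat
  rw [normalizedVolume, dif_pos hne, htrans, latticeVolume, measureReal_def,
    measure_preimage_add, ← measureReal_def, hset]
  rw [latticeVolume] at hvol
  rw [hvol, Module.finrank_eq_card_basis b]
  field_simp

end Volume

end

/-! ### The theorem: triangulation and unimodularity combined -/

theorem corollary3p13 {V E : Type*} [Fintype V] [Nonempty V] [Fintype E]
    (G : DirectedMultigraph V E) (hG : G.IsAcyclic)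
    (a : V → ℤ) (ha : G.IsConservationist a) (Φ : G.Framing) :
    IsUnimodularLatticeTriangulation (G.flowPolytope a)
        (DirectedMultigraph.framingTriangulation a Φ) ∧
      (∀ K : Finset (G.Layering a), Φ.IsLayeringSimplex K →
        AffineIndependent ℝ (fun L : K => (L : G.Layering a).indicator) ∧
        DirectedMultigraph.polyhedralSimplex K =
          convexHull ℝ (DirectedMultigraph.Layering.indicator '' (K : Set (G.Layering a)))) ∧
      ∀ K L : Finset (G.Layering a), Φ.IsLayeringSimplex K → Φ.IsLayeringSimplex L →
        DirectedMultigraph.polyhedralSimplex K ∩ DirectedMultigraph.polyhedralSimplex L =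
          DirectedMultigraph.polyhedralSimplex (K ∩ L) := by
  have : Finite G.Route := DirectedMultigraph.Route.finite hG
  have := Fintype.ofFinite G.Route
  refine ⟨⟨Φ.isLatticeTriangulation hG ha, ?_⟩, fun K hK =>
    ⟨(hK.linearIndependent hG ha).affineIndependent,
      DirectedMultigraph.polyhedralSimplex_eq hG ha K⟩, fun K L hK hL =>
    DirectedMultigraph.Framing.polyhedralSimplex_inter hG ha hK hL⟩
  rintro _ ⟨K, hK, rfl⟩ hne
  rw [DirectedMultigraph.polyhedralSimplex_eq hG ha] at hne ⊢
  rw [Set.image_eq_range] at hne ⊢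
  have hKne : Nonempty K := by
    obtain ⟨_, ⟨L, -⟩⟩ := convexHull_nonempty_iff.1 hne
    exact ⟨L⟩
  refine normalizedVolume_convexHull_range (ι := K) (hK.linearIndependent hG ha).affineIndependent
    (fun L => L.1.isIntegerPoint_indicator) fun y _ hy L => ?_
  -- Extension by `0` outside `K`, since `isInteger` takes coefficients defined on all layerings.
  let y' : G.Layering a → ℝ := fun N => if h : N ∈ K then y ⟨N, h⟩ else 0
  have hy' : ∀ N : K, y' N = y N := fun N => dif_pos N.2
  rw [← hy']
  refine hK.isInteger hG ha ?_ L L.2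
  rw [← Finset.sum_coe_sort]
  simpa only [hy'] using hy
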